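/- **Theorem (Noncommutative majorization principle for $2K$-th moments).** Let $M_k(\mathbb C)$ denote the $k\times k$ complex matrices, $\|\cdot\|$ the operator norm, $|A|=(AA^*)^{1/2}$, and for $p>n$ let $\iota(A)=\begin{pmatrix}A&0\\0&0\end{pmatrix}\in M_p(\mathbb C)$ be the zero-padding of $A\in M_n(\mathbb C)$. A noncommutative multilinear polynomial in $m$ variables is $$Q(X_1,\dots,X_m)=\sum_{S\subseteq\{1,\dots,m\}}\widehat Q(S)\prod_{i\in S}X_i,\qquad \widehat Q(S)\in M_n(\mathbb C),$$ with each product taken in increasing order of the indices; its degree is $\max\{|S|:\widehat Q(S)\ne0\}$ ($0$ if $Q=0$). For $\sigma\in\{-1,1\}^m$, $Q(\sigma)$ means $Q(\sigma_1I,\dots,\sigma_mI)$. Put $Q^\iota(X_1,\dots,X_m)=\sum_S\iota(\widehat Q(S))\prod_{i\in S}X_i$ for $X_i\in M_p(\mathbb C)$, and $$\tau=\max_{1\le i\le m}\ \sum_{S\ni i}\operatorname{Tr}\big(\widehat Q(S)\widehat Q(S)^*\big).$$ For all integers $m,n\ge1$ there is a constant $C=C(m,n)>0$, depending only on $m$ and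 $n$, such that the following holds. Let $p>n$, $K\ge1$ and $d\ge0$ be integers. Let $Q$ be a noncommutative multilinear polynomial in $m$ variables with coefficients in $M_n(\mathbb C)$, of degree at most $d$, such that $\|Q(\sigma)\|\le1$ for all $\sigma\in\{-1,1\}^m$. Let $G_1,\dots,G_m$ be i.i.d. random matrices in $M_n(\mathbb C)$ with $\mathbb E\,G_1=0$ and $\mathbb E\,G_1G_1^*=I$, such that $(G_1G_1^*)^K$ is integrable and $\|\mathbb E(G_1G_1^*)^K\|\le c_K$ for some real $c_K\ge1$. Let $H_1,\dots,H_m$ be independent Haar-distributed random $p\times p$ unitary matrices, independent of the $G_i$, and let $b_1,\dots,b_m$ be i.i.d. uniform in $\{-1,1\}$. Then $\operatorname{Tr}|Q^\iota(\iota(G_1)H_1,\dots,\iota(G_m)H_m)|^{2K}$ is integrable and $$\mathbb E\,\tfrac1n\operatorname{Tr}\big|Q^\iota(\iota(G_1)H_1,\dots,\iota(G_m)H_m)\big|^{2K}\le \mathbb E\,\tfrac1n\operatorname{Tr}\big|Q(b_1,\dots,b_m)\big|^{2K}+K^3(2K-1)^{dK}c_K^{\,d}\,n^{2K}\tau^{1/4}+C\,p^{-1/2}K^2\tau^{-1/4},$$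 where the last term is read as $0$ if $\tau=0$. Moreover, for $K=2$, $$\mathbb E\,\tfrac1n\operatorname{Tr}\big|Q^\iota(\iota(G_1)H_1,\dots,\iota(G_m)H_m)\big|^{4}\le \mathbb E\,\tfrac1n\operatorname{Tr}\big|Q(b_1,\dots,b_m)\big|^{4}+8(8c_2)^{4d}n^{4}\tau^{1/4}+C\,p^{-1/2}.$$ -/

import Mathlib

open MeasureTheory

namespace NCMajorization

/-! ### Matrices -/

/-- The operator norm (largest singular value) of a square complex matrix, i.e. the norm of the
operator it induces on the Euclidean space `ℂᵏ`. -/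
noncomputable def opNorm {k : ℕ} (A : Matrix (Fin k) (Fin k) ℂ) : ℝ :=
  ‖Matrix.toEuclideanCLM (n := Fin k) (𝕜 := ℂ) A‖

/-- The absolute value `|A| = (A A*)^{1/2}`, by the functional calculus of Hermitian matrices. -/
noncomputable def matAbs {k : ℕ} (A : Matrix (Fin k) (Fin k) ℂ) : Matrix (Fin k) (Fin k) ℂ :=
  cfc Real.sqrt (A * A.conjTranspose)

/-- The zero-padding `ι` which puts an `n × n` matrix in the top left corner of a `p × p` matrix. -/
def pad {n : ℕ} (p : ℕ) (A : Matrix (Fin n) (Fin n) ℂ) : Matrix (Fin p) (Fin p) ℂ :=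
  Matrix.of fun i j =>
    if h : (i : ℕ) < n ∧ (j : ℕ) < n then A ⟨i, h.1⟩ ⟨j, h.2⟩ else 0

/-! ### Noncommutative multilinear polynomials -/

/-- A noncommutative multilinear polynomial in `m` variables with `n × n` matrix coefficients,
`∑ S, Q S * ∏_{i ∈ S} X i`, given by its family of coefficients. -/
abbrev NCPoly (n m : ℕ) : Type := Finset (Fin m) → Matrix (Fin n) (Fin n) ℂ

/-- The value at the matrices `X 1, …, X m`; in each monomial the variables are multiplied in
increasing order of their indices. -/
noncomputable def NCPoly.eval {n m : ℕ} (Q : NCPoly n m)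
    (X : Fin m → Matrix (Fin n) (Fin n) ℂ) : Matrix (Fin n) (Fin n) ℂ :=
  ∑ S : Finset (Fin m), Q S * ((S.sort (· ≤ ·)).map X).prod

/-- The value at a point `σ` of the cube `{-1, 1}ᵐ`: the `i`-th variable is `σ i` times the
identity matrix. -/
noncomputable def NCPoly.evalSign {n m : ℕ} (Q : NCPoly n m) (σ : Fin m → ℤˣ) :
    Matrix (Fin n) (Fin n) ℂ :=
  Q.eval fun i => (((σ i : ℤˣ) : ℤ) : ℂ) • (1 : Matrix (Fin n) (Fin n) ℂ)

open Classical in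
/-- The degree, the largest size of a set with a nonzero coefficient. -/
noncomputable def NCPoly.degree {n m : ℕ} (Q : NCPoly n m) : ℕ :=
  (Finset.univ.filter fun S => Q S ≠ 0).sup Finset.card

/-- The influence of the `i`-th variable. -/
noncomputable def NCPoly.influence {n m : ℕ} (Q : NCPoly n m) (i : Fin m) : ℝ :=
  ∑ S ∈ Finset.univ.filter (fun S : Finset (Fin m) => i ∈ S),
    (Matrix.trace (Q S * (Q S).conjTranspose)).re

/-- The maximum influence. -/
noncomputable def NCPoly.maxInfluence {n m : ℕ} (Q : NCPoly n m) : ℝ :=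
  ⨆ i : Fin m, Q.influence i

/-- The zero-padded extension of a polynomial, whose variables are `p × p` matrices. -/
def NCPoly.padded {n m : ℕ} (p : ℕ) (Q : NCPoly n m) : NCPoly p m := fun S => pad p (Q S)

/-- The Boolean moment: the mean of `(1/n) Tr |Q(b)|^{2K}` over uniform signs `b`. -/
noncomputable def NCPoly.signMoment {n m : ℕ} (Q : NCPoly n m) (K : ℕ) : ℝ :=
  ((2 : ℝ) ^ m)⁻¹ * ∑ σ : Fin m → ℤˣ,
    (1 / (n : ℝ)) * (Matrix.trace (matAbs (Q.evalSign σ) ^ (2 * K))).re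

/-! ### Random matrices -/

/-- The product, equivalently Borel, sigma-algebra on matrices. -/
noncomputable instance matrixMeasurableSpace {k : ℕ} : MeasurableSpace (Matrix (Fin k) (Fin k) ℂ) :=
  inferInstanceAs (MeasurableSpace (Fin k → Fin k → ℂ))

instance matrixBorelSpace {k : ℕ} : BorelSpace (Matrix (Fin k) (Fin k) ℂ) :=
  inferInstanceAs (BorelSpace (Fin k → Fin k → ℂ))

/-- The entrywise expectation of a random matrix. -/
noncomputable def matExpect {Ω : Type*} [MeasurableSpace Ω] {k : ℕ} (μ : Measure Ω)
    (X : Ω → Matrix (Fin k) (Fin k) ℂ) : Matrix (Fin k) (Fin k) ℂ :=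
  Matrix.of fun i j => ∫ ω, X ω i j ∂μ

/-- Every entry of the random matrix is integrable. -/
def MatIntegrable {Ω : Type*} [MeasurableSpace Ω] {k : ℕ} (μ : Measure Ω)
    (X : Ω → Matrix (Fin k) (Fin k) ℂ) : Prop :=
  ∀ i j, Integrable (fun ω => X ω i j) μ

/-- The law `ν` of a random matrix `G` satisfies `E G = 0` and `E G G* = I`. -/
structure IsNormalizedEnsemble {n : ℕ} (ν : Measure (Matrix (Fin n) (Fin n) ℂ)) : Prop where
  integrable : MatIntegrable ν fun G => G
  mean : matExpect ν (fun G => G) = 0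
  integrable_sq : MatIntegrable ν fun G => G * G.conjTranspose
  second : matExpect ν (fun G => G * G.conjTranspose) = 1

instance unitaryCompactSpace {p : ℕ} : CompactSpace (Matrix.unitaryGroup (Fin p) ℂ) := by
  have hcl : IsClosed (Matrix.unitaryGroup (Fin p) ℂ : Set (Matrix (Fin p) (Fin p) ℂ)) := by
    have h : (Matrix.unitaryGroup (Fin p) ℂ : Set (Matrix (Fin p) (Fin p) ℂ))
        = {A | A * star A = 1} := by
      ext A
      exact Matrix.mem_unitaryGroup_iff
    rw [h]
    exact isClosed_eq (by fun_prop) continuous_const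
  have hK : IsCompact (Set.pi Set.univ fun _ : Fin p =>
      Set.pi Set.univ fun _ : Fin p => Metric.closedBall (0 : ℂ) 1) :=
    isCompact_univ_pi fun _ => isCompact_univ_pi fun _ => isCompact_closedBall 0 1
  have hU : IsCompact (Matrix.unitaryGroup (Fin p) ℂ : Set (Matrix (Fin p) (Fin p) ℂ)) := by
    refine IsCompact.of_isClosed_subset (X := Matrix (Fin p) (Fin p) ℂ) hK hcl ?_
    intro A hA i _ j _
    simpa using entry_norm_bound_of_unitary hA i j
  exact isCompact_iff_compactSpace.mp hU

/-- The normalized Haar measure on the group of `p × p` unitary matrices. -/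
noncomputable def haarUnitary (p : ℕ) : Measure (Matrix.unitaryGroup (Fin p) ℂ) :=
  Measure.haarMeasure ⊤

instance haarUnitary_isProbabilityMeasure (p : ℕ) : IsProbabilityMeasure (haarUnitary p) :=
  ⟨by simpa [haarUnitary] using
    Measure.haarMeasure_self (K₀ := (⊤ : TopologicalSpace.PositiveCompacts
      (Matrix.unitaryGroup (Fin p) ℂ)))⟩

/-- The joint law of `(G 1, …, G m, H 1, …, H m)`, all independent, the `G i` with law `ν` and the
`H i` Haar distributed on the `p × p` unitary group. -/
noncomputable def inputLaw {n : ℕ} (m p : ℕ) (ν : Measure (Matrix (Fin n) (Fin n) ℂ)) :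
    Measure ((Fin m → Matrix (Fin n) (Fin n) ℂ) × (Fin m → Matrix.unitaryGroup (Fin p) ℂ)) :=
  (Measure.pi fun _ : Fin m => ν).prod (Measure.pi fun _ : Fin m => haarUnitary p)

/-- The quantity `(1/n) Tr |Q^ι(ι(G 1) H 1, …, ι(G m) H m)|^{2K}`. -/
noncomputable def NCPoly.rotatedTrace {n m : ℕ} (Q : NCPoly n m) (p K : ℕ)
    (x : (Fin m → Matrix (Fin n) (Fin n) ℂ) × (Fin m → Matrix.unitaryGroup (Fin p) ℂ)) : ℝ :=
  (1 / (n : ℝ)) * (Matrix.trace (matAbs ((Q.padded p).eval fun i =>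
    pad p (x.1 i) * (x.2 i : Matrix (Fin p) (Fin p) ℂ)) ^ (2 * K))).re

end NCMajorization

open NCMajorization

/-!
Write `Y S` for the monomial of index `S` of the padded polynomial at the variables `ι(G i) H i`.
Expanding `Tr (Y Yᴴ)ᴷ` for `Y = ∑ S, Y S` gives a sum of traces of words
`∏ j, Y (s j) (Y (t j))ᴴ`, indexed by two `K`-tuples of sets; `mult s i` is the number of members of
`s` containing `i`. The words are treated according to their multiplicities.

* Multiplying `H i` by a phase shows that only words with `mult s = mult t` have nonzero expectation
  (`NCPoly.integral_wordTrace_eq_zero`).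
* A class of such words is bounded, by the arithmetic-geometric mean inequality and a count of the
  tuples with given multiplicities (`sum_mult_eq_le`), by `K ^ (d K)` times a sum of
  `E ∏ j, ‖Y (s j)‖²` in the Hilbert–Schmidt norm. Conditioning on all but one `G i` at a time gives
  `E ‖Y S‖²ᴷ ≤ c ^ |S| ‖Q S‖²ᴷ` (`lintegral_hsSq_mul_prod_le`), so the class contributes at most
  `c ^ d K ^ (d K)` times the sum of `∏ j, ‖Q (s j)‖²` (`NCPoly.sum_wordTrace_le`). If some index is
  required to occur twice, that sum is at most a multiple of the maximal influence `τ`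
  (`NCPoly.sum_repeated_le`), because `∑ S, ‖Q S‖² ≤ n` by Parseval's identity. The base `K` of this
  bound, in place of `2 K - 1`, leaves room for the factors `d` and `K` that the union bounds cost
  (`mul_le_influenceError`).
* A word in which no index repeats contains, unless it is diagonal with letters of degree at most
  one, an `n × n` corner of `H i` or of `H i (H j)ᴴ` with `i ≠ j`. The entries of these unitary
  matrices have second moment `1 / p`, so such a word is of order `p ^ (-1 / 2)`
  (`NCPoly.norm_integral_wordTrace_le`).
* The remaining diagonal words have expectation `Tr ∏ j, Q (s j) (Q (s j))ᴴ`. Up to words with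
  repeated indices they sum to `Tr (∑ S, Q S (Q S)ᴴ)ᴷ` over `|S| ≤ 1`, which Jensen's inequality for
  the trace bounds by the Boolean moment (`NCPoly.re_trace_pow_le_signMoment`).

The number of nonrepeating words depends on `K`. If `K ≥ 2 m` the estimate of the second point,
applied to all words with a nonempty member, suffices by itself and no corners are needed
(`NCPoly.integral_rotatedTrace_le_of_influence`); otherwise `K` is bounded in terms of `m`.
-/

namespace NCMajorization

open Matrix
open scoped ComplexOrder

/-! ### The Hilbert–Schmidt norm and trace inequalities -/

section Hs
variable {ι κ μ : Type*} [Fintype ι] [Fintype κ] [Fintype μ]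

/-- The squared Hilbert–Schmidt norm. -/
noncomputable def hsSq (A : Matrix ι κ ℂ) : ℝ := ∑ i, ∑ j, ‖A i j‖ ^ 2

/-- The Hilbert–Schmidt norm. -/
noncomputable def hsNorm (A : Matrix ι κ ℂ) : ℝ := √(hsSq A)

lemma hsSq_nonneg (A : Matrix ι κ ℂ) : 0 ≤ hsSq A := by unfold hsSq; positivity

lemma hsNorm_nonneg (A : Matrix ι κ ℂ) : 0 ≤ hsNorm A := Real.sqrt_nonneg _

lemma hsNorm_sq (A : Matrix ι κ ℂ) : hsNorm A ^ 2 = hsSq A := Real.sq_sqrt (hsSq_nonneg A)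

attribute [local instance] Matrix.frobeniusNormedAddCommGroup in
lemma hsNorm_eq_frobenius (A : Matrix ι κ ℂ) : hsNorm A = ‖A‖ := by
  rw [frobenius_norm_def, hsNorm, hsSq, Real.sqrt_eq_rpow]
  simp

lemma hsNorm_mul_le (A : Matrix ι κ ℂ) (B : Matrix κ μ ℂ) :
    hsNorm (A * B) ≤ hsNorm A * hsNorm B := by
  simp only [hsNorm_eq_frobenius]
  exact frobenius_norm_mul A B

lemma hsNorm_conjTranspose (A : Matrix ι κ ℂ) : hsNorm Aᴴ = hsNorm A := by
  simp only [hsNorm_eq_frobenius]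
  exact frobenius_norm_conjTranspose A

lemma hsNorm_zero : hsNorm (0 : Matrix ι κ ℂ) = 0 := by simp [hsNorm, hsSq]

lemma trace_mul_conjTranspose (A : Matrix ι κ ℂ) : trace (A * Aᴴ) = (hsSq A : ℂ) := by
  simp [trace, mul_apply, hsSq, Complex.mul_conj, Complex.normSq_eq_norm_sq]

lemma eq_zero_of_hsSq_eq_zero {A : Matrix ι κ ℂ} (h : hsSq A = 0) : A = 0 := by
  rw [hsSq, Finset.sum_eq_zero_iff_of_nonneg (fun i _ => by positivity)] at h
  ext i j
  have := (Finset.sum_eq_zero_iff_of_nonneg (fun j _ => by positivity)).1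
    (h i (Finset.mem_univ _)) j (Finset.mem_univ _)
  simpa using this

lemma hsNorm_mul_of_mul_conjTranspose_eq_one [DecidableEq κ] (A : Matrix ι κ ℂ)
    {U : Matrix κ μ ℂ} (hU : U * Uᴴ = 1) : hsNorm (A * U) = hsNorm A := by
  have : (hsSq (A * U) : ℂ) = hsSq A := by
    rw [← trace_mul_conjTranspose, ← trace_mul_conjTranspose, conjTranspose_mul,
      Matrix.mul_assoc, ← Matrix.mul_assoc U, hU, Matrix.one_mul]
  rw [hsNorm, hsNorm, Complex.ofReal_injective this]

lemma hsNorm_mul_of_conjTranspose_mul_eq_one [DecidableEq κ] (A : Matrix κ ι ℂ)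
    {U : Matrix μ κ ℂ} (hU : Uᴴ * U = 1) : hsNorm (U * A) = hsNorm A := by
  rw [← hsNorm_conjTranspose, conjTranspose_mul,
    hsNorm_mul_of_mul_conjTranspose_eq_one _ (by simpa using hU), hsNorm_conjTranspose]

lemma norm_trace_mul_le (A : Matrix ι κ ℂ) (B : Matrix κ ι ℂ) :
    ‖trace (A * B)‖ ≤ hsNorm A * hsNorm B := by
  have h1 : ‖trace (A * B)‖ ≤ ∑ x : ι × κ, ‖A x.1 x.2‖ * ‖B x.2 x.1‖ := by
    simp only [trace, mul_apply, diag_apply, Fintype.sum_prod_type]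
    refine (norm_sum_le _ _).trans (Finset.sum_le_sum fun i _ => (norm_sum_le _ _).trans ?_)
    simp
  refine h1.trans ((Real.sum_mul_le_sqrt_mul_sqrt _ _ _).trans (le_of_eq ?_))
  rw [hsNorm, hsNorm, hsSq, hsSq, Fintype.sum_prod_type, Fintype.sum_prod_type_right]

lemma hsNorm_one [DecidableEq ι] : hsNorm (1 : Matrix ι ι ℂ) = √(Fintype.card ι) := by
  have : (hsSq (1 : Matrix ι ι ℂ) : ℂ) = Fintype.card ι := by
    rw [← trace_mul_conjTranspose]; simp
  rw [hsNorm]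
  congr 1
  exact_mod_cast this

lemma norm_trace_le (A : Matrix ι ι ℂ) : ‖trace A‖ ≤ √(Fintype.card ι) * hsNorm A := by
  classical
  have := norm_trace_mul_le (1 : Matrix ι ι ℂ) A
  rwa [Matrix.one_mul, hsNorm_one] at this

end Hs

section Spectral
variable {ι κ : Type*} [Fintype ι] [Fintype κ] [DecidableEq ι]

/-- The spectral theorem, in a form that diagonalizes all powers of `M` at once. -/
lemma exists_unitary_diagonal {M : Matrix ι ι ℂ} (hM : M.PosSemidef) :
    ∃ (U : Matrix ι ι ℂ) (l : ι → ℝ), U * Uᴴ = 1 ∧ Uᴴ * U = 1 ∧ (∀ i, 0 ≤ l i) ∧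
      ∀ k : ℕ, M ^ k = U * diagonal (fun i => ((l i ^ k : ℝ) : ℂ)) * Uᴴ := by
  refine ⟨hM.1.eigenvectorUnitary, hM.1.eigenvalues, ?_, ?_, fun i => hM.eigenvalues_nonneg i, ?_⟩
  · exact Unitary.coe_mul_star_self _
  · exact Unitary.coe_star_mul_self _
  · intro k
    conv_lhs => rw [hM.1.spectral_theorem]
    rw [← map_pow, diagonal_pow, Unitary.conjStarAlgAut_apply]
    simp only [star_eq_conjTranspose]
    congr 3
    ext i
    simp

lemma trace_mul_diagonal_mul (C : Matrix κ ι ℂ) (l : ι → ℝ) :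
    trace (C * diagonal (fun i => (l i : ℂ)) * Cᴴ) = ((∑ i, (∑ a, ‖C a i‖ ^ 2) * l i : ℝ) : ℂ) := by
  simp only [trace, diag_apply, mul_apply (N := Cᴴ), mul_diagonal, conjTranspose_apply,
    Complex.ofReal_sum, Complex.ofReal_mul, Finset.sum_mul]
  rw [Finset.sum_comm]
  refine Finset.sum_congr rfl fun i _ => Finset.sum_congr rfl fun a _ => ?_
  have : (C a i) * star (C a i) = ((‖C a i‖ ^ 2 : ℝ) : ℂ) := by
    rw [← Complex.normSq_eq_norm_sq]; exact Complex.mul_conj _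
  rw [mul_right_comm, this]

/-- Jensen's inequality for `x ↦ x ^ (K + 1)` and the spectral measure of `M` with respect to the
rows of `C`. It bounds a moment by a quantity that is linear in the power `M ^ (K + 1)`. -/
lemma re_trace_conj_pow_le (C : Matrix κ ι ℂ) {M : Matrix ι ι ℂ} (hM : M.PosSemidef) (K : ℕ) :
    (trace (C * M * Cᴴ)).re ^ (K + 1) ≤ hsSq C ^ K * (trace (C * M ^ (K + 1) * Cᴴ)).re := by
  obtain ⟨U, l, hU, hU', hl, hp⟩ := exists_unitary_diagonal hM
  have key : ∀ k : ℕ, (trace (C * M ^ k * Cᴴ)).re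
      = ∑ i, (∑ a, ‖(C * U) a i‖ ^ 2) * l i ^ k := by
    intro k
    have := trace_mul_diagonal_mul (C * U) (fun i => l i ^ k)
    rw [hp, ← Complex.ofReal_re (∑ i, _), ← this, conjTranspose_mul]
    simp only [Matrix.mul_assoc]
  have h0 : hsSq C = ∑ i, (∑ a, ‖(C * U) a i‖ ^ 2) := by
    have := key 0
    simp only [pow_zero, Matrix.mul_one, mul_one, trace_mul_conjTranspose, Complex.ofReal_re] at this
    exact this
  have h1 := key 1
  rw [pow_one] at h1
  rw [h1, key (K + 1), h0]
  set w : ι → ℝ := fun i => ∑ a, ‖(C * U) a i‖ ^ 2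
  have hw : ∀ i, 0 ≤ w i := fun i => by positivity
  rcases (Finset.sum_nonneg fun i (_ : i ∈ Finset.univ) => hw i).eq_or_lt with h | h
  · have hz : ∀ i, w i = 0 := fun i =>
      (Finset.sum_eq_zero_iff_of_nonneg fun i _ => hw i).1 h.symm i (Finset.mem_univ i)
    change (∑ i, w i * l i ^ 1) ^ (K + 1) ≤ (∑ i, w i) ^ K * ∑ i, w i * l i ^ (K + 1)
    simp [hz]
  · have hJ := Real.pow_arith_mean_le_arith_mean_pow Finset.univ (fun i => w i / ∑ j, w j) l
      (fun i _ => div_nonneg (hw i) h.le) (by rw [← Finset.sum_div, div_self h.ne'])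
      (fun i _ => hl i) (K + 1)
    have e1 : ∀ z : ι → ℝ, ∑ i, w i / (∑ j, w j) * z i = (∑ i, w i * z i) / ∑ j, w j := by
      intro z; rw [Finset.sum_div]; exact Finset.sum_congr rfl fun i _ => by ring
    rw [e1, e1, div_pow, div_le_div_iff₀ (by positivity) h] at hJ
    have : (∑ i, w i * l i) ^ (K + 1) * (∑ j, w j)
        ≤ ((∑ j, w j) ^ K * ∑ i, w i * l i ^ (K + 1)) * ∑ j, w j := by
      calc _ ≤ _ := hJ
        _ = _ := by ring
    simpa [w] using le_of_mul_le_mul_right this h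

/-- Young's inequality for natural exponents. -/
lemma succ_mul_pow_mul_le {a b : ℝ} (ha : 0 ≤ a) (hb : 0 ≤ b) (k : ℕ) :
    ((k : ℝ) + 1) * (a ^ k * b) ≤ k * a ^ (k + 1) + b ^ (k + 1) := by
  induction k with
  | zero => simp
  | succ k ih =>
    have h1 := mul_le_mul_of_nonneg_right ih hb
    have h2 : 0 ≤ ((k : ℝ) + 1) * (a ^ k * (a - b) ^ 2) := by positivity
    push_cast
    ring_nf at h1 h2 ⊢
    nlinarith

/-- Young's inequality for traces. -/
lemma young_trace {N M : Matrix ι ι ℂ} (hN : N.PosSemidef) (hM : M.PosSemidef) (k : ℕ) :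
    ((k : ℝ) + 1) * (trace (N ^ k * M)).re
      ≤ k * (trace (N ^ (k + 1))).re + (trace (M ^ (k + 1))).re := by
  obtain ⟨U, a, hU, hU', ha, hNp⟩ := exists_unitary_diagonal hN
  obtain ⟨V, b, hV, hV', hb, hMp⟩ := exists_unitary_diagonal hM
  have key : ∀ k l : ℕ, (trace (N ^ k * M ^ l)).re
      = ∑ i, ∑ j, ‖(Vᴴ * U) j i‖ ^ 2 * (a i ^ k * b j ^ l) := by
    intro k l
    have e : trace (N ^ k * M ^ l) = trace (diagonal (fun j => ((b j ^ l : ℝ) : ℂ)) *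
        ((Vᴴ * U) * diagonal (fun i => ((a i ^ k : ℝ) : ℂ)) * (Vᴴ * U)ᴴ)) := by
      rw [hNp, hMp, trace_mul_comm (diagonal _)]
      simp only [conjTranspose_mul, conjTranspose_conjTranspose]
      rw [← Matrix.mul_assoc _ _ Vᴴ, trace_mul_comm _ Vᴴ]
      simp only [Matrix.mul_assoc]
    rw [e]
    simp only [trace, diag_apply, diagonal_mul, mul_apply (N := (Vᴴ * U)ᴴ), mul_diagonal,
      conjTranspose_apply (Vᴴ * U), Complex.re_sum, Finset.mul_sum]
    rw [Finset.sum_comm]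
    refine Finset.sum_congr rfl fun i _ => Finset.sum_congr rfl fun j _ => ?_
    have : (Vᴴ * U) j i * star ((Vᴴ * U) j i) = ((‖(Vᴴ * U) j i‖ ^ 2 : ℝ) : ℂ) := by
      rw [← Complex.normSq_eq_norm_sq]; exact Complex.mul_conj _
    rw [mul_right_comm, this, ← Complex.ofReal_mul, ← Complex.ofReal_mul, Complex.ofReal_re]
    ring
  have h1 := key k 1
  have h2 := key (k + 1) 0
  have h3 := key 0 (k + 1)
  simp only [pow_one, pow_zero, mul_one, one_mul] at h1 h2 h3
  rw [h1, h2, h3]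
  simp only [Finset.mul_sum, ← Finset.sum_add_distrib]
  refine Finset.sum_le_sum fun i _ => Finset.sum_le_sum fun j _ => ?_
  have := mul_le_mul_of_nonneg_left (succ_mul_pow_mul_le (ha i) (hb j) k)
    (sq_nonneg ‖(Vᴴ * U) j i‖)
  linarith

end Spectral

/-! ### Padding -/

/-- The isometric inclusion `ℂⁿ → ℂᵖ` onto the first `n` coordinates. -/
def incl (n p : ℕ) : Matrix (Fin p) (Fin n) ℂ :=
  Matrix.of fun i j => if (i : ℕ) = j then 1 else 0

lemma incl_conjTranspose_mul_incl {n p : ℕ} (h : n ≤ p) : (incl n p)ᴴ * incl n p = 1 := by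
  ext a b
  rw [mul_apply, Finset.sum_eq_single (Fin.castLE h a)]
  · simp [incl, one_apply, Fin.ext_iff]
  · intro c _ hc
    have : (c : ℕ) ≠ a := fun e => hc (Fin.ext (by simpa using e))
    simp [incl, this]
  · simp

lemma pad_eq {n p : ℕ} (A : Matrix (Fin n) (Fin n) ℂ) : pad p A = incl n p * A * (incl n p)ᴴ := by
  ext i j
  simp only [pad, of_apply, mul_apply, incl, conjTranspose_apply, ite_mul, one_mul, zero_mul]
  by_cases hi : (i : ℕ) < n
  · by_cases hj : (j : ℕ) < n
    · rw [dif_pos ⟨hi, hj⟩, Finset.sum_eq_single ⟨j, hj⟩, Finset.sum_eq_single ⟨i, hi⟩]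
      · simp
      · intro b _ hb
        rw [if_neg]; intro e; exact hb (Fin.ext e.symm)
      · simp
      · intro b _ hb
        have : (j : ℕ) ≠ b := fun e => hb (Fin.ext e.symm)
        simp [this]
      · simp
    · rw [dif_neg (fun h => hj h.2)]
      symm
      refine Finset.sum_eq_zero fun b _ => ?_
      have : (j : ℕ) ≠ b := fun e => hj (e ▸ b.2)
      simp [this]
  · rw [dif_neg (fun h => hi h.1)]
    symm
    refine Finset.sum_eq_zero fun b _ => ?_
    have : ∀ c : Fin n, (i : ℕ) ≠ c := fun c e => hi (e ▸ c.2)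
    simp [this]

lemma pad_mul_pad {n p : ℕ} (h : n ≤ p) (A B : Matrix (Fin n) (Fin n) ℂ) :
    pad p A * pad p B = pad p (A * B) := by
  simp only [pad_eq, Matrix.mul_assoc]
  rw [← Matrix.mul_assoc (incl n p)ᴴ, incl_conjTranspose_mul_incl h, Matrix.one_mul]

lemma pad_conjTranspose {n p : ℕ} (A : Matrix (Fin n) (Fin n) ℂ) : (pad p A)ᴴ = pad p Aᴴ := by
  simp [pad_eq, Matrix.mul_assoc]

lemma trace_pad {n p : ℕ} (h : n ≤ p) (A : Matrix (Fin n) (Fin n) ℂ) :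
    trace (pad p A) = trace A := by
  rw [pad_eq, Matrix.mul_assoc, trace_mul_comm, Matrix.mul_assoc, incl_conjTranspose_mul_incl h,
    Matrix.mul_one]

lemma hsNorm_incl_mul {n p : ℕ} {κ : Type*} [Fintype κ] (h : n ≤ p) (A : Matrix (Fin n) κ ℂ) :
    hsNorm (incl n p * A) = hsNorm A :=
  hsNorm_mul_of_conjTranspose_mul_eq_one _ (incl_conjTranspose_mul_incl h)

lemma hsNorm_mul_incl_conjTranspose {n p : ℕ} {κ : Type*} [Fintype κ] (h : n ≤ p)
    (A : Matrix κ (Fin n) ℂ) : hsNorm (A * (incl n p)ᴴ) = hsNorm A :=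
  hsNorm_mul_of_mul_conjTranspose_eq_one _ (by simpa using incl_conjTranspose_mul_incl h)

lemma hsNorm_pad {n p : ℕ} (h : n ≤ p) (A : Matrix (Fin n) (Fin n) ℂ) :
    hsNorm (pad p A) = hsNorm A := by
  rw [pad_eq, hsNorm_mul_incl_conjTranspose h, hsNorm_incl_mul h]

lemma mul_incl_apply {n p : ℕ} {κ : Type*} (h : n ≤ p) (A : Matrix κ (Fin p) ℂ) (a : κ)
    (b : Fin n) : (A * incl n p) a b = A a (Fin.castLE h b) := by
  rw [mul_apply, Finset.sum_eq_single (Fin.castLE h b)]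
  · simp [incl]
  · intro c _ hc
    have : (c : ℕ) ≠ b := fun e => hc (Fin.ext (by simpa using e))
    simp [incl, this]
  · simp

lemma incl_conjTranspose_mul_apply {n p : ℕ} {κ : Type*} (h : n ≤ p) (A : Matrix (Fin p) κ ℂ)
    (a : Fin n) (b : κ) : ((incl n p)ᴴ * A) a b = A (Fin.castLE h a) b := by
  have := congrArg star (mul_incl_apply h Aᴴ b a)
  rwa [← conjTranspose_apply, conjTranspose_mul, conjTranspose_conjTranspose, conjTranspose_apply,
    star_star] at this

lemma hsSq_mul_incl_le {n p : ℕ} {κ : Type*} [Fintype κ] (A : Matrix κ (Fin p) ℂ) (h : n ≤ p) :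
    hsSq (A * incl n p) ≤ hsSq A := by
  simp only [hsSq, mul_incl_apply h]
  refine Finset.sum_le_sum fun i _ => ?_
  rw [← Finset.sum_image (f := fun c => ‖A i c‖ ^ 2)
    (fun a _ b _ h' => Fin.castLE_injective h h')]
  exact Finset.sum_le_sum_of_subset_of_nonneg (Finset.subset_univ _) (fun _ _ _ => by positivity)

lemma matAbs_pow_two_mul {k : ℕ} (A : Matrix (Fin k) (Fin k) ℂ) (K : ℕ) :
    matAbs A ^ (2 * K) = (A * Aᴴ) ^ K := by
  have hP : (A * Aᴴ).PosSemidef := posSemidef_self_mul_conjTranspose A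
  have hsa : IsSelfAdjoint (A * Aᴴ) := hP.1
  rw [pow_mul]
  congr 1
  rw [matAbs, ← cfc_pow Real.sqrt 2 (A * Aᴴ)]
  conv_rhs => rw [← cfc_id' ℝ (A * Aᴴ)]
  refine cfc_congr fun x hx => ?_
  rw [hP.1.spectrum_real_eq_range_eigenvalues] at hx
  obtain ⟨i, rfl⟩ := hx
  exact Real.sq_sqrt (hP.eigenvalues_nonneg i)

/-! ### Words -/

/-- A power of a sum of noncommuting elements is a sum over words. -/
lemma sum_pow_eq_sum_ofFn {R α : Type*} [Semiring R] [Fintype α] (f : α → R) (K : ℕ) :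
    (∑ a, f a) ^ K = ∑ w : Fin K → α, (List.ofFn fun j => f (w j)).prod := by
  induction K with
  | zero => simp
  | succ K ih =>
    rw [pow_succ', ih, Finset.sum_mul_sum, ← Finset.sum_product',
      Finset.univ_product_univ]
    refine Fintype.sum_equiv (Fin.consEquiv fun _ : Fin (K + 1) => α) _ _ fun x => ?_
    simp [List.ofFn_succ]

section Mult
variable {m K : ℕ}

/-- The number of members of the tuple `s` containing each index. -/
def mult (s : Fin K → Finset (Fin m)) (i : Fin m) : ℕ := (Finset.univ.filter fun j => i ∈ s j).card

lemma sum_mult (s : Fin K → Finset (Fin m)) : ∑ i, mult s i = ∑ j, (s j).card := by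
  simp only [mult, Finset.card_filter]
  rw [Finset.sum_comm]
  simp

/-- A tuple is determined by the positions at which each index occurs. -/
lemma card_filter_mult_le (κ : Fin m → ℕ) :
    (Finset.univ.filter fun s : Fin K → Finset (Fin m) => mult s = κ).card
      ≤ ∏ i, K.choose (κ i) := by
  have : ∏ i, K.choose (κ i)
      = (Fintype.piFinset fun i => Finset.powersetCard (κ i) (Finset.univ : Finset (Fin K))).card := by
    simp [Fintype.card_piFinset, Finset.card_powersetCard]
  rw [this]
  refine Finset.card_le_card_of_injOn (fun s i => Finset.univ.filter fun j => i ∈ s j) ?_ ?_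
  · intro s hs
    have hs' : mult s = κ := by simpa using hs
    simp only [Finset.mem_coe, Fintype.mem_piFinset, Finset.mem_powersetCard, Finset.subset_univ,
      true_and]
    intro i
    exact congrFun hs' i
  · intro s _ t _ hst
    funext j
    ext i
    have := congrFun hst i
    simpa using congrArg (j ∈ ·) this

/-- Hypercontractivity in combinatorial form: the sum over pairs of tuples with equal
multiplicities is at most `K ^ (d * K)` times the diagonal sum. After `2ab ≤ a² + b²` this is a count
of the tuples with given multiplicities, a product of binomial coefficients. -/
lemma sum_mult_eq_le {d : ℕ} (P : (Fin m → ℕ) → Prop) [DecidablePred P] (y : Finset (Fin m) → ℝ)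
    (hd : ∀ S, y S ≠ 0 → S.card ≤ d) :
    ∑ s : Fin K → Finset (Fin m), ∑ t : Fin K → Finset (Fin m),
        (if P (mult s) ∧ mult s = mult t then (∏ j, y (s j)) * ∏ j, y (t j) else 0)
      ≤ (K : ℝ) ^ (d * K) *
        ∑ s : Fin K → Finset (Fin m), if P (mult s) then ∏ j, y (s j) ^ 2 else 0 := by
  have hN : ∀ s : Fin K → Finset (Fin m), (∏ j, y (s j)) ≠ 0 →
      ((Finset.univ.filter fun t : Fin K → Finset (Fin m) => mult t = mult s).card : ℝ)
        ≤ (K : ℝ) ^ (d * K) := by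
    intro s hs
    have h1 := card_filter_mult_le (K := K) (mult s)
    have h2 : ∏ i, K.choose (mult s i) ≤ K ^ (∑ i, mult s i) := by
      rw [← Finset.prod_pow_eq_pow_sum]
      exact Finset.prod_le_prod' fun i _ => Nat.choose_le_pow _ _
    have h3 : ∑ i, mult s i ≤ d * K := by
      rw [sum_mult]
      calc ∑ j, (s j).card ≤ ∑ _j : Fin K, d := Finset.sum_le_sum fun j _ =>
            hd _ (Finset.prod_ne_zero_iff.1 hs j (Finset.mem_univ j))
        _ = d * K := by simp [mul_comm]
    have h4 : K ^ (∑ i, mult s i) ≤ K ^ (d * K) := by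
      rcases Nat.eq_zero_or_pos K with rfl | hK
      · simp [mult]
      · exact Nat.pow_le_pow_right hK h3
    exact_mod_cast h1.trans (h2.trans h4)
  have half : ∀ s : Fin K → Finset (Fin m),
      ∑ t : Fin K → Finset (Fin m), (if P (mult s) ∧ mult s = mult t then (∏ j, y (s j)) ^ 2 else 0)
        ≤ (K : ℝ) ^ (d * K) * if P (mult s) then ∏ j, y (s j) ^ 2 else 0 := by
    intro s
    by_cases hP : P (mult s)
    · simp only [hP, true_and, if_true, Finset.prod_pow]
      rw [← Finset.sum_filter, Finset.sum_const, nsmul_eq_mul]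
      by_cases h0 : ∏ j, y (s j) = 0
      · simp [h0]
      · refine mul_le_mul_of_nonneg_right ?_ (by positivity)
        have := hN s h0
        simpa only [eq_comm] using this
    · simp [hP]
  calc _ ≤ ∑ s : Fin K → Finset (Fin m), ∑ t : Fin K → Finset (Fin m),
        ((if P (mult s) ∧ mult s = mult t then (∏ j, y (s j)) ^ 2 else 0)
          + if P (mult t) ∧ mult t = mult s then (∏ j, y (t j)) ^ 2 else 0) / 2 := by
        refine Finset.sum_le_sum fun s _ => Finset.sum_le_sum fun t _ => ?_
        by_cases h : P (mult s) ∧ mult s = mult t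
        · have h' : P (mult t) ∧ mult t = mult s := ⟨h.2 ▸ h.1, h.2.symm⟩
          rw [if_pos h, if_pos h, if_pos h']
          nlinarith [sq_nonneg ((∏ j, y (s j)) - ∏ j, y (t j))]
        · have h' : ¬ (P (mult t) ∧ mult t = mult s) := fun h' => h ⟨h'.2 ▸ h'.1, h'.2.symm⟩
          rw [if_neg h, if_neg h, if_neg h']
          simp
    _ = ∑ s : Fin K → Finset (Fin m), ∑ t : Fin K → Finset (Fin m),
        (if P (mult s) ∧ mult s = mult t then (∏ j, y (s j)) ^ 2 else 0) := by
        simp only [← Finset.sum_div, Finset.sum_add_distrib]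
        rw [Finset.sum_comm (f := fun s t =>
          if P (mult t) ∧ mult t = mult s then (∏ j, y (t j)) ^ 2 else (0 : ℝ))]
        ring
    _ ≤ _ := by
        rw [Finset.mul_sum]
        exact Finset.sum_le_sum fun s _ => half s

/-- A sum over tuples factors over the positions; those in `J` are restricted by `p`. -/
lemma sum_prod_ite {v : Finset (Fin m) → ℝ} (J : Finset (Fin K)) (p : Finset (Fin m) → Prop)
    [DecidablePred p] :
    ∑ s : Fin K → Finset (Fin m), (if ∀ j ∈ J, p (s j) then ∏ j, v (s j) else 0)
      = (∑ S, if p S then v S else 0) ^ J.card * (∑ S, v S) ^ (K - J.card) := by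
  have h1 : ∀ s : Fin K → Finset (Fin m), (if ∀ j ∈ J, p (s j) then ∏ j, v (s j) else 0)
      = ∏ j, if j ∈ J then (if p (s j) then v (s j) else 0) else v (s j) := by
    intro s
    by_cases h : ∀ j ∈ J, p (s j)
    · rw [if_pos h]
      refine Finset.prod_congr rfl fun j _ => ?_
      by_cases hj : j ∈ J
      · simp [hj, h j hj]
      · simp [hj]
    · rw [if_neg h]
      push Not at h
      obtain ⟨j, hj, hp⟩ := h
      symm
      exact Finset.prod_eq_zero (Finset.mem_univ j) (by simp [hj, hp])
  simp only [h1]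
  have h2 := Finset.prod_univ_sum (fun _ : Fin K => (Finset.univ : Finset (Finset (Fin m))))
    (fun j S => if j ∈ J then (if p S then v S else 0) else v S)
  rw [Fintype.piFinset_univ] at h2
  rw [← h2]
  have h3 : ∀ j : Fin K, ∑ S, (if j ∈ J then (if p S then v S else 0) else v S)
      = if j ∈ J then (∑ S, if p S then v S else 0) else ∑ S, v S := by
    intro j; by_cases hj : j ∈ J <;> simp [hj]
  simp only [h3]
  rw [Finset.prod_ite, Finset.prod_const, Finset.prod_const, Finset.filter_mem_eq_inter,
    Finset.univ_inter, Finset.filter_not, Finset.filter_mem_eq_inter, Finset.univ_inter,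
    Finset.card_sdiff_of_subset (Finset.subset_univ _), Finset.card_univ, Fintype.card_fin]

/-- Union bound over the position of a nonempty set. -/
lemma sum_mult_ne_zero_le {v : Finset (Fin m) → ℝ} (hv : ∀ S, 0 ≤ v S) :
    ∑ s : Fin K → Finset (Fin m), (if mult s ≠ 0 then ∏ j, v (s j) else 0)
      ≤ K * ((∑ S, if S ≠ ∅ then v S else 0) * (∑ S, v S) ^ (K - 1)) := by
  calc _ ≤ ∑ s : Fin K → Finset (Fin m), ∑ j0 : Fin K,
        (if ∀ j ∈ ({j0} : Finset (Fin K)), s j ≠ ∅ then ∏ j, v (s j) else 0) := by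
        refine Finset.sum_le_sum fun s _ => ?_
        have hnn : 0 ≤ ∏ j, v (s j) := Finset.prod_nonneg fun j _ => hv _
        have hnn' : ∀ j0 ∈ (Finset.univ : Finset (Fin K)),
            0 ≤ (if ∀ j ∈ ({j0} : Finset (Fin K)), s j ≠ ∅ then ∏ j, v (s j) else 0) :=
          fun _ _ => by split_ifs <;> first | exact hnn | exact le_rfl
        by_cases h : mult s ≠ 0
        · rw [if_pos h]
          obtain ⟨i, hi⟩ := Function.ne_iff.1 h
          obtain ⟨j0, hj0⟩ := Finset.card_ne_zero.1 hi
          have hmem : i ∈ s j0 := by simpa using hj0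
          refine le_trans (le_of_eq ?_) (Finset.single_le_sum hnn' (Finset.mem_univ j0))
          rw [if_pos]
          intro j hj
          rw [Finset.mem_singleton] at hj
          subst hj
          exact Finset.ne_empty_of_mem hmem
        · rw [if_neg h]
          exact Finset.sum_nonneg hnn'
    _ = _ := by
        rw [Finset.sum_comm]
        simp only [sum_prod_ite (p := fun S => S ≠ ∅), Finset.card_singleton, pow_one, Finset.sum_const, Finset.card_univ,
          Fintype.card_fin, nsmul_eq_mul]

/-- Union bound over a repeated index and two positions at which it occurs. -/
lemma sum_two_le_mult_le {v : Finset (Fin m) → ℝ} (hv : ∀ S, 0 ≤ v S) :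
    ∑ s : Fin K → Finset (Fin m), (if ∃ i, 2 ≤ mult s i then ∏ j, v (s j) else 0)
      ≤ (K : ℝ) * (K - 1) *
        ((∑ i, (∑ S, if i ∈ S then v S else 0) ^ 2) * (∑ S, v S) ^ (K - 2)) := by
  calc _ ≤ ∑ s : Fin K → Finset (Fin m), ∑ i : Fin m,
        ∑ q ∈ (Finset.univ : Finset (Fin K)).offDiag,
        (if ∀ j ∈ ({q.1, q.2} : Finset (Fin K)), i ∈ s j then ∏ j, v (s j) else 0) := by
        refine Finset.sum_le_sum fun s _ => ?_
        have hnn : 0 ≤ ∏ j, v (s j) := Finset.prod_nonneg fun j _ => hv _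
        have hnn' : ∀ i : Fin m, ∀ q ∈ (Finset.univ : Finset (Fin K)).offDiag,
            0 ≤ (if ∀ j ∈ ({q.1, q.2} : Finset (Fin K)), i ∈ s j then ∏ j, v (s j) else 0) :=
          fun _ _ _ => by split_ifs <;> first | exact hnn | exact le_rfl
        by_cases h : ∃ i, 2 ≤ mult s i
        · rw [if_pos h]
          obtain ⟨i, hi⟩ := h
          obtain ⟨a, ha, b, hb, hab⟩ := Finset.one_lt_card.1 hi
          have ha' : i ∈ s a := by simpa using ha
          have hb' : i ∈ s b := by simpa using hb
          refine le_trans ?_ (Finset.single_le_sum (f := fun i =>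
            ∑ q ∈ (Finset.univ : Finset (Fin K)).offDiag,
            (if ∀ j ∈ ({q.1, q.2} : Finset (Fin K)), i ∈ s j then ∏ j, v (s j) else 0))
            (fun i _ => Finset.sum_nonneg (hnn' i)) (Finset.mem_univ i))
          refine le_trans (le_of_eq ?_) (Finset.single_le_sum (hnn' i)
            (show (a, b) ∈ _ by simpa using hab))
          rw [if_pos]
          intro j hj
          simp only [Finset.mem_insert, Finset.mem_singleton] at hj
          rcases hj with rfl | rfl <;> assumption
        · rw [if_neg h]
          exact Finset.sum_nonneg fun i _ => Finset.sum_nonneg (hnn' i)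
    _ = _ := by
        rw [Finset.sum_comm, Finset.sum_mul, Finset.mul_sum]
        refine Finset.sum_congr rfl fun i _ => ?_
        rw [Finset.sum_comm]
        simp only [sum_prod_ite (p := fun S => i ∈ S)]
        rw [Finset.sum_congr rfl (g := fun _ => (∑ S, if i ∈ S then v S else 0) ^ 2 *
          (∑ S, v S) ^ (K - 2)), Finset.sum_const, Finset.offDiag_card, nsmul_eq_mul]
        · congr 1
          rw [Finset.card_univ, Fintype.card_fin, Nat.cast_sub (Nat.le_mul_self K)]
          push_cast; ring
        · intro q hq
          rw [Finset.mem_offDiag] at hq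
          rw [Finset.card_pair hq.2.2]

end Mult

/-! ### Resampling one coordinate -/

section Resample
variable {E : Type*} [MeasurableSpace E] {m : ℕ}

/-- Replacing one coordinate by an independent copy preserves a product law. -/
lemma measurePreserving_update (ν : Measure E) [IsProbabilityMeasure ν] (i : Fin m) :
    MeasurePreserving (fun q : E × (Fin m → E) => Function.update q.2 i q.1)
      (ν.prod (Measure.pi fun _ : Fin m => ν)) (Measure.pi fun _ : Fin m => ν) := by
  have hm : Measurable (fun q : E × (Fin m → E) => Function.update q.2 i q.1) := by
    rw [measurable_pi_iff]
    intro a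
    by_cases h : a = i
    · subst h; simpa using measurable_fst
    · simpa [Function.update_of_ne h, Function.comp_def] using
        (measurable_pi_apply a).comp (measurable_snd (α := E) (β := Fin m → E))
  refine ⟨hm, ?_⟩
  symm
  refine Measure.pi_eq fun s hs => ?_
  rw [Measure.map_apply hm (MeasurableSet.univ_pi hs)]
  have : (fun q : E × (Fin m → E) => Function.update q.2 i q.1) ⁻¹' Set.univ.pi s
      = (s i) ×ˢ (Set.univ.pi (Function.update s i Set.univ)) := by
    ext q
    simp only [Set.mem_preimage, Set.mem_pi, Set.mem_univ, true_implies, Set.mem_prod]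
    constructor
    · intro h
      refine ⟨by simpa using h i, fun a => ?_⟩
      by_cases ha : a = i
      · subst ha; simp
      · simpa [Function.update_of_ne ha] using h a
    · rintro ⟨h1, h2⟩ a
      by_cases ha : a = i
      · subst ha; simpa using h1
      · simpa [Function.update_of_ne ha] using h2 a
  rw [this, Measure.prod_prod, Measure.pi_pi, ← Finset.mul_prod_erase _ _ (Finset.mem_univ i),
    ← Finset.mul_prod_erase _ (fun a => ν (s a)) (Finset.mem_univ i)]
  simp only [Function.update_self, measure_univ, one_mul]
  congr 1
  refine Finset.prod_congr rfl fun a ha => ?_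
  rw [Function.update_of_ne (Finset.ne_of_mem_erase ha)]

lemma lintegral_pi_resample (ν : Measure E) [IsProbabilityMeasure ν] (i : Fin m)
    {f : (Fin m → E) → ENNReal} (hf : Measurable f) :
    ∫⁻ x, f x ∂(Measure.pi fun _ : Fin m => ν)
      = ∫⁻ y, ∫⁻ x, f (Function.update x i y) ∂(Measure.pi fun _ : Fin m => ν) ∂ν := by
  have h := measurePreserving_update ν i
  rw [← h.lintegral_comp hf]
  exact lintegral_prod _ (hf.comp h.measurable).aemeasurable

lemma integral_pi_mul {ν : Measure E} [IsProbabilityMeasure ν] (i : Fin m) {a : E → ℂ}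
    {g : (Fin m → E) → ℂ} (ha : Measurable a) (hg : Measurable g)
    (hgi : ∀ x y, g (Function.update x i y) = g x) :
    ∫ x, a (x i) * g x ∂(Measure.pi fun _ : Fin m => ν)
      = (∫ y, a y ∂ν) * ∫ x, g x ∂(Measure.pi fun _ : Fin m => ν) := by
  have h := measurePreserving_update (m := m) ν i
  have hf : Measurable fun x : Fin m → E => a (x i) * g x :=
    (ha.comp (measurable_pi_apply i)).mul hg
  rw [← h.map_eq, integral_map h.measurable.aemeasurable hf.aestronglyMeasurable, h.map_eq,
    ← integral_prod_mul]
  simp [hgi]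

end Resample

/-! ### Measurability of random matrices -/

instance matrixSecondCountable {k : ℕ} : SecondCountableTopology (Matrix (Fin k) (Fin k) ℂ) :=
  inferInstanceAs (SecondCountableTopology (Fin k → Fin k → ℂ))

instance haarUnitary_isMulLeftInvariant (p : ℕ) : (haarUnitary p).IsMulLeftInvariant := by
  unfold haarUnitary; infer_instance

lemma continuous_hsNorm {ι κ : Type*} [Fintype ι] [Fintype κ] :
    Continuous (hsNorm : Matrix ι κ ℂ → ℝ) := by
  unfold hsNorm hsSq
  fun_prop

lemma continuous_pad {n p : ℕ} : Continuous (pad p : Matrix (Fin n) (Fin n) ℂ → _) := by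
  have : (pad p : Matrix (Fin n) (Fin n) ℂ → _) = fun A => incl n p * A * (incl n p)ᴴ := by
    funext A; exact pad_eq A
  rw [this]
  fun_prop

/-! ### Moments of a single factor -/

lemma hsSq_mul_le {n : ℕ} {κ : Type*} [Fintype κ] (A : Matrix (Fin n) (Fin n) ℂ)
    (D : Matrix (Fin n) κ ℂ) : hsSq (A * D) ≤ opNorm A ^ 2 * hsSq D := by
  have col : ∀ {D : Matrix (Fin n) κ ℂ}, hsSq D = ∑ a, ‖WithLp.toLp 2 (fun i => D i a)‖ ^ 2 := by
    intro D
    simp only [EuclideanSpace.norm_sq_eq, hsSq]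
    rw [Finset.sum_comm]
  rw [col, col, Finset.mul_sum]
  refine Finset.sum_le_sum fun a _ => ?_
  rw [← mul_pow]
  refine pow_le_pow_left₀ (norm_nonneg _) ?_ 2
  have := (Matrix.toEuclideanCLM (n := Fin n) (𝕜 := ℂ) A).le_opNorm
    (WithLp.toLp 2 (fun i => D i a))
  exact this

lemma re_trace_conj_le {n : ℕ} {κ : Type*} [Fintype κ] (C : Matrix κ (Fin n) ℂ)
    (E : Matrix (Fin n) (Fin n) ℂ) : (trace (C * E * Cᴴ)).re ≤ opNorm E * hsSq C := by
  have h0 : 0 ≤ opNorm E := norm_nonneg _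
  have h1 : hsNorm (E * Cᴴ) ≤ opNorm E * hsNorm C := by
    rw [← hsNorm_conjTranspose C, ← Real.sqrt_sq h0, hsNorm, hsNorm, ← Real.sqrt_mul (sq_nonneg _)]
    exact Real.sqrt_le_sqrt (hsSq_mul_le _ _)
  calc _ ≤ ‖trace (C * (E * Cᴴ))‖ := by rw [Matrix.mul_assoc]; exact Complex.re_le_norm _
    _ ≤ hsNorm C * (opNorm E * hsNorm C) :=
        (norm_trace_mul_le _ _).trans (mul_le_mul_of_nonneg_left h1 (hsNorm_nonneg _))
    _ = _ := by rw [← hsNorm_sq]; ring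

section Moments
variable {n : ℕ} {ν : Measure (Matrix (Fin n) (Fin n) ℂ)}

lemma integral_trace_conj {κ : Type*} [Fintype κ] {X : Matrix (Fin n) (Fin n) ℂ → Matrix (Fin n) (Fin n) ℂ}
    (hX : MatIntegrable ν X) (C : Matrix κ (Fin n) ℂ) :
    Integrable (fun y => trace (C * X y * Cᴴ)) ν ∧
      ∫ y, trace (C * X y * Cᴴ) ∂ν = trace (C * matExpect ν X * Cᴴ) := by
  have e : ∀ Z : Matrix (Fin n) (Fin n) ℂ, trace (C * Z * Cᴴ)
      = ∑ a, ∑ j, ∑ i, C a i * Z i j * star (C a j) := by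
    intro Z
    simp [trace, mul_apply, Finset.sum_mul]
  have hi : ∀ a j i, Integrable (fun y => C a i * X y i j * star (C a j)) ν := fun a j i =>
    ((hX i j).const_mul _).mul_const _
  simp only [e]
  refine ⟨integrable_finsetSum _ fun a _ => integrable_finsetSum _ fun j _ =>
    integrable_finsetSum _ fun i _ => hi a j i, ?_⟩
  rw [integral_finsetSum _ fun a _ => integrable_finsetSum _ fun j _ =>
    integrable_finsetSum _ fun i _ => hi a j i]
  refine Finset.sum_congr rfl fun a _ => ?_
  rw [integral_finsetSum _ fun j _ => integrable_finsetSum _ fun i _ => hi a j i]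
  refine Finset.sum_congr rfl fun j _ => ?_
  rw [integral_finsetSum _ fun i _ => hi a j i]
  refine Finset.sum_congr rfl fun i _ => ?_
  rw [integral_mul_const, integral_const_mul]
  rfl

lemma hsSq_mul_eq_re_trace {κ : Type*} [Fintype κ] (C : Matrix κ (Fin n) ℂ)
    (y : Matrix (Fin n) (Fin n) ℂ) : hsSq (C * y) = (trace (C * (y * yᴴ) * Cᴴ)).re := by
  have := trace_mul_conjTranspose (C * y)
  rw [conjTranspose_mul, Matrix.mul_assoc, ← Matrix.mul_assoc y, ← Matrix.mul_assoc] at this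
  rw [this, Complex.ofReal_re]

/-- The moment condition on `G Gᴴ` controls Hilbert–Schmidt moments of `C * G`, without loss of a
dimensional factor. -/
lemma lintegral_hsSq_mul_le {κ : Type*} [Fintype κ] {K : ℕ} (hK : 1 ≤ K) {c : ℝ}
    (hi : MatIntegrable ν fun G => (G * Gᴴ) ^ K)
    (hc : opNorm (matExpect ν fun G => (G * Gᴴ) ^ K) ≤ c) (C : Matrix κ (Fin n) ℂ) :
    ∫⁻ y, ENNReal.ofReal (hsSq (C * y) ^ K) ∂ν ≤ ENNReal.ofReal (c * hsSq C ^ K) := by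
  obtain ⟨k, rfl⟩ : ∃ k, K = k + 1 := ⟨K - 1, by omega⟩
  obtain ⟨h1, h2⟩ := integral_trace_conj hi C
  have hpt : ∀ y : Matrix (Fin n) (Fin n) ℂ, hsSq (C * y) ^ (k + 1)
      ≤ hsSq C ^ k * (trace (C * (y * yᴴ) ^ (k + 1) * Cᴴ)).re := by
    intro y
    rw [hsSq_mul_eq_re_trace]
    exact re_trace_conj_pow_le C (posSemidef_self_mul_conjTranspose y) k
  have hnn : ∀ y : Matrix (Fin n) (Fin n) ℂ, 0 ≤ hsSq C ^ k * (trace (C * (y * yᴴ) ^ (k + 1) * Cᴴ)).re := fun y =>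
    (pow_nonneg (hsSq_nonneg _) _).trans (hpt y)
  calc _ ≤ ∫⁻ y, ENNReal.ofReal (hsSq C ^ k * (trace (C * (y * yᴴ) ^ (k + 1) * Cᴴ)).re) ∂ν :=
        lintegral_mono fun y => ENNReal.ofReal_le_ofReal (hpt y)
    _ = ENNReal.ofReal (∫ y, hsSq C ^ k * (trace (C * (y * yᴴ) ^ (k + 1) * Cᴴ)).re ∂ν) :=
        (ofReal_integral_eq_lintegral_ofReal (h1.re.const_mul _)
          (Filter.Eventually.of_forall hnn)).symm
    _ ≤ _ := by
        refine ENNReal.ofReal_le_ofReal ?_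
        have h3 : ∫ y, (trace (C * (y * yᴴ) ^ (k + 1) * Cᴴ)).re ∂ν
            = (∫ y, trace (C * (y * yᴴ) ^ (k + 1) * Cᴴ) ∂ν).re := integral_re h1
        rw [integral_const_mul, h3, h2]
        calc _ ≤ hsSq C ^ k * (opNorm (matExpect ν fun G => (G * Gᴴ) ^ (k + 1)) * hsSq C) :=
              mul_le_mul_of_nonneg_left (re_trace_conj_le C _) (pow_nonneg (hsSq_nonneg _) _)
          _ ≤ hsSq C ^ k * (c * hsSq C) :=
              mul_le_mul_of_nonneg_left (mul_le_mul_of_nonneg_right hc (hsSq_nonneg _))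
                (pow_nonneg (hsSq_nonneg _) _)
          _ = _ := by ring

lemma continuous_hsSq {ι κ : Type*} [Fintype ι] [Fintype κ] :
    Continuous (hsSq : Matrix ι κ ℂ → ℝ) := by
  unfold hsSq
  fun_prop

lemma integrable_hsSq_pow {K : ℕ} (hK : 1 ≤ K) 
    (hi : MatIntegrable ν fun G => (G * Gᴴ) ^ K) :
    Integrable (fun G => hsSq G ^ K) ν := by
  have := lintegral_hsSq_mul_le hK hi le_rfl (1 : Matrix (Fin n) (Fin n) ℂ)
  simp only [Matrix.one_mul] at this
  refine ⟨(continuous_hsSq.measurable.pow_const K).aestronglyMeasurable, ?_⟩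
  rw [hasFiniteIntegral_iff_ofReal
    (Filter.Eventually.of_forall fun G => pow_nonneg (hsSq_nonneg G) K)]
  exact this.trans_lt ENNReal.ofReal_lt_top

lemma IsNormalizedEnsemble.integral_hsSq (h : IsNormalizedEnsemble ν) :
    Integrable (fun G => hsSq G) ν ∧ ∫ G, hsSq G ∂ν = n := by
  obtain ⟨h1, h2⟩ := integral_trace_conj h.integrable_sq (1 : Matrix (Fin n) (Fin n) ℂ)
  have e : ∀ y : Matrix (Fin n) (Fin n) ℂ, hsSq y
      = (trace ((1 : Matrix (Fin n) (Fin n) ℂ) * (y * yᴴ) * (1 : Matrix (Fin n) (Fin n) ℂ)ᴴ)).re := by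
    intro y
    rw [← hsSq_mul_eq_re_trace, Matrix.one_mul]
  simp only [e]
  refine ⟨h1.re, ?_⟩
  have h3 := integral_re h1
  simp only [RCLike.re_eq_complex_re] at h3
  rw [h3, h2, h.second]
  simp

/-! ### Moments of monomials -/

/-- The random variable `ι(G) H`. -/
noncomputable def rotVar {m : ℕ} (p : ℕ) (G : Fin m → Matrix (Fin n) (Fin n) ℂ)
    (H : Fin m → Matrix.unitaryGroup (Fin p) ℂ) (i : Fin m) : Matrix (Fin p) (Fin p) ℂ :=
  pad p (G i) * (H i : Matrix (Fin p) (Fin p) ℂ)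

variable {m p : ℕ}

lemma unitary_mul_conjTranspose (U : Matrix.unitaryGroup (Fin p) ℂ) :
    (U : Matrix (Fin p) (Fin p) ℂ) * (U : Matrix (Fin p) (Fin p) ℂ)ᴴ = 1 :=
  Matrix.mem_unitaryGroup_iff.1 U.2

lemma hsSq_mul_rotVar (h : n ≤ p) (B : Matrix (Fin p) (Fin p) ℂ)
    (G : Fin m → Matrix (Fin n) (Fin n) ℂ) (H : Fin m → Matrix.unitaryGroup (Fin p) ℂ)
    (i : Fin m) : hsSq (B * rotVar p G H i) = hsSq (B * incl n p * G i) := by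
  rw [← hsNorm_sq, ← hsNorm_sq, rotVar, ← Matrix.mul_assoc,
    hsNorm_mul_of_mul_conjTranspose_eq_one _ (unitary_mul_conjTranspose _), pad_eq,
    ← Matrix.mul_assoc, ← Matrix.mul_assoc, hsNorm_mul_incl_conjTranspose h]

lemma continuous_rotVar (i : Fin m) : Continuous
    fun x : (Fin m → Matrix (Fin n) (Fin n) ℂ) × (Fin m → Matrix.unitaryGroup (Fin p) ℂ) =>
      rotVar p x.1 x.2 i := by
  unfold rotVar
  refine (continuous_pad.comp ((continuous_apply i).comp continuous_fst)).mul ?_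
  exact continuous_subtype_val.comp ((continuous_apply i).comp continuous_snd)

lemma continuous_prod_rotVar (l : List (Fin m)) : Continuous
    fun x : (Fin m → Matrix (Fin n) (Fin n) ℂ) × (Fin m → Matrix.unitaryGroup (Fin p) ℂ) =>
      (l.map (rotVar p x.1 x.2)).prod :=
  continuous_list_prod l fun i _ => continuous_rotVar i

lemma continuous_prod_rotVar_left (H : Fin m → Matrix.unitaryGroup (Fin p) ℂ) (l : List (Fin m)) :
    Continuous fun G : Fin m → Matrix (Fin n) (Fin n) ℂ => (l.map (rotVar p G H)).prod := by
  refine continuous_list_prod l fun i _ => ?_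
  exact Continuous.matrix_mul (continuous_pad.comp (continuous_apply i)) continuous_const

lemma prod_rotVar_update {l : List (Fin m)} {i : Fin m} (hi : i ∉ l)
    (G : Fin m → Matrix (Fin n) (Fin n) ℂ) (H : Fin m → Matrix.unitaryGroup (Fin p) ℂ)
    (y : Matrix (Fin n) (Fin n) ℂ) :
    (l.map (rotVar p (Function.update G i y) H)).prod = (l.map (rotVar p G H)).prod := by
  congr 1
  refine List.map_congr_left fun a ha => ?_
  have hai : a ≠ i := fun e => hi (e ▸ ha)
  rw [rotVar, rotVar, Function.update_of_ne hai]

/-- A `2K`-th moment of a monomial costs one factor `c` for each variable. The factors are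
integrated from the left, and `B` collects those already fixed. -/
lemma lintegral_hsSq_mul_prod_le [IsProbabilityMeasure ν] (h : n ≤ p) {K : ℕ} (hK : 1 ≤ K) {c : ℝ}
    (hc0 : 0 ≤ c) (hi : MatIntegrable ν fun G => (G * Gᴴ) ^ K)
    (hc : opNorm (matExpect ν fun G => (G * Gᴴ) ^ K) ≤ c)
    (H : Fin m → Matrix.unitaryGroup (Fin p) ℂ) {l : List (Fin m)} (hl : l.Nodup)
    (B : Matrix (Fin p) (Fin p) ℂ) :
    ∫⁻ G, ENNReal.ofReal (hsSq (B * (l.map (rotVar p G H)).prod) ^ K)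
        ∂(Measure.pi fun _ : Fin m => ν)
      ≤ ENNReal.ofReal (c ^ l.length * hsSq B ^ K) := by
  induction l generalizing B with
  | nil => simp
  | cons i l ih =>
    have hil := (List.nodup_cons.1 hl).1
    have hmeas : Measurable fun G : Fin m → Matrix (Fin n) (Fin n) ℂ =>
        ENNReal.ofReal (hsSq (B * ((i :: l).map (rotVar p G H)).prod) ^ K) := by
      refine ENNReal.measurable_ofReal.comp (Measurable.pow_const ?_ K)
      refine (continuous_hsSq.comp ?_).measurable
      have h1 : Continuous fun G : Fin m → Matrix (Fin n) (Fin n) ℂ =>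
          ((i :: l).map (rotVar p G H)).prod :=
        continuous_prod_rotVar_left H (i :: l)
      exact Continuous.matrix_mul continuous_const h1
    rw [lintegral_pi_resample ν i hmeas]
    calc _ ≤ ∫⁻ y, ENNReal.ofReal (c ^ l.length * hsSq (B * incl n p * y) ^ K) ∂ν := by
          refine lintegral_mono fun y => ?_
          have e : ∀ G : Fin m → Matrix (Fin n) (Fin n) ℂ,
              B * ((i :: l).map (rotVar p (Function.update G i y) H)).prod
                = (B * rotVar p (fun _ => y) H i) * (l.map (rotVar p G H)).prod := by
            intro G
            rw [List.map_cons, List.prod_cons, prod_rotVar_update hil, ← Matrix.mul_assoc]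
            congr 2
            simp [rotVar]
          simp only [e]
          refine (ih (List.nodup_cons.1 hl).2 _).trans (le_of_eq ?_)
          rw [hsSq_mul_rotVar h]
      _ = ENNReal.ofReal (c ^ l.length) *
            ∫⁻ y, ENNReal.ofReal (hsSq (B * incl n p * y) ^ K) ∂ν := by
          rw [← lintegral_const_mul]
          · simp only [ENNReal.ofReal_mul (pow_nonneg hc0 _)]
          · refine ENNReal.measurable_ofReal.comp (Measurable.pow_const ?_ K)
            exact (continuous_hsSq.comp (Continuous.matrix_mul continuous_const continuous_id)).measurable
      _ ≤ ENNReal.ofReal (c ^ l.length) * ENNReal.ofReal (c * hsSq (B * incl n p) ^ K) := by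
          gcongr
          exact lintegral_hsSq_mul_le hK hi hc _
      _ ≤ _ := by
          rw [← ENNReal.ofReal_mul (pow_nonneg hc0 _)]
          refine ENNReal.ofReal_le_ofReal ?_
          rw [List.length_cons, pow_succ, mul_assoc]
          gcongr
          · exact hsSq_nonneg _
          · exact hsSq_mul_incl_le B h

end Moments

/-! ### Traces of words -/

instance unitarySecondCountable {p : ℕ} :
    SecondCountableTopology (Matrix.unitaryGroup (Fin p) ℂ) :=
  inferInstanceAs (SecondCountableTopology
    ((Matrix.unitaryGroup (Fin p) ℂ : Set (Matrix (Fin p) (Fin p) ℂ))))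

section WordTrace
variable {n m p K : ℕ}

/-- The monomial of index `S` of the padded polynomial at the random matrices `ι(G i) H i`. -/
noncomputable def NCPoly.term (Q : NCPoly n m) (p : ℕ)
    (x : (Fin m → Matrix (Fin n) (Fin n) ℂ) × (Fin m → Matrix.unitaryGroup (Fin p) ℂ))
    (S : Finset (Fin m)) : Matrix (Fin p) (Fin p) ℂ :=
  pad p (Q S) * ((S.sort (· ≤ ·)).map (rotVar p x.1 x.2)).prod

/-- The trace of the word `∏ j, Y (s j) (Y (t j))ᴴ`, where `Y S` is the monomial of index `S`. -/
noncomputable def NCPoly.wordTrace (Q : NCPoly n m) (p : ℕ)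
    (x : (Fin m → Matrix (Fin n) (Fin n) ℂ) × (Fin m → Matrix.unitaryGroup (Fin p) ℂ))
    (s t : Fin K → Finset (Fin m)) : ℂ :=
  trace (List.ofFn fun j => Q.term p x (s j) * (Q.term p x (t j))ᴴ).prod

lemma trace_mul_conjTranspose_pow_sum {N : ℕ} {α : Type*} [Fintype α]
    (Y : α → Matrix (Fin N) (Fin N) ℂ) (K : ℕ) :
    trace (((∑ a, Y a) * (∑ a, Y a)ᴴ) ^ K)
      = ∑ s : Fin K → α, ∑ t : Fin K → α, trace (List.ofFn fun j => Y (s j) * (Y (t j))ᴴ).prod := by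
  have h : (∑ a, Y a) * (∑ a, Y a)ᴴ = ∑ q : α × α, Y q.1 * (Y q.2)ᴴ := by
    rw [conjTranspose_sum, Finset.sum_mul_sum, Fintype.sum_prod_type]
  rw [h, sum_pow_eq_sum_ofFn, trace_sum]
  rw [← Fintype.sum_prod_type' (f := fun s t : Fin K → α =>
    trace (List.ofFn fun j => Y (s j) * (Y (t j))ᴴ).prod)]
  exact Fintype.sum_equiv (Equiv.arrowProdEquivProdArrow (Fin K) _ _) _ _ fun w => rfl

lemma NCPoly.rotatedTrace_eq (Q : NCPoly n m) (p K : ℕ)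
    (x : (Fin m → Matrix (Fin n) (Fin n) ℂ) × (Fin m → Matrix.unitaryGroup (Fin p) ℂ)) :
    Q.rotatedTrace p K x = (1 / (n : ℝ)) *
      ∑ s : Fin K → Finset (Fin m), ∑ t : Fin K → Finset (Fin m), (Q.wordTrace p x s t).re := by
  rw [NCPoly.rotatedTrace, matAbs_pow_two_mul]
  congr 1
  have := trace_mul_conjTranspose_pow_sum (Q.term p x) K
  simp only [← Complex.re_sum]
  rw [show (∑ s : Fin K → Finset (Fin m), ∑ t : Fin K → Finset (Fin m), Q.wordTrace p x s t) = _
    from this.symm]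
  rfl

lemma NCPoly.continuous_term (Q : NCPoly n m) (S : Finset (Fin m)) :
    Continuous fun x => Q.term p x S :=
  Continuous.matrix_mul continuous_const (continuous_prod_rotVar _)

lemma continuous_prod_ofFn {X : Type*} [TopologicalSpace X] {N K : ℕ}
    {f : Fin K → X → Matrix (Fin N) (Fin N) ℂ} (hf : ∀ j, Continuous (f j)) :
    Continuous fun x => (List.ofFn fun j => f j x).prod := by
  induction K with
  | zero => simpa using continuous_const
  | succ K ih =>
    simp only [List.ofFn_succ, List.prod_cons]
    exact Continuous.matrix_mul (hf 0) (ih fun j => hf j.succ)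

lemma NCPoly.continuous_wordTrace (Q : NCPoly n m) (s t : Fin K → Finset (Fin m)) :
    Continuous fun x => Q.wordTrace p x s t := by
  refine Continuous.matrix_trace (continuous_prod_ofFn fun j => ?_)
  exact Continuous.matrix_mul (Q.continuous_term _) (Q.continuous_term _).matrix_conjTranspose

lemma hsNorm_mul_prod_rotVar_le (h : n ≤ p) (G : Fin m → Matrix (Fin n) (Fin n) ℂ)
    (H : Fin m → Matrix.unitaryGroup (Fin p) ℂ) (l : List (Fin m)) (B : Matrix (Fin p) (Fin p) ℂ) :
    hsNorm (B * (l.map (rotVar p G H)).prod) ≤ hsNorm B * (l.map fun i => hsNorm (G i)).prod := by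
  induction l generalizing B with
  | nil => simp
  | cons i l ih =>
    rw [List.map_cons, List.prod_cons, ← Matrix.mul_assoc, List.map_cons, List.prod_cons,
      ← mul_assoc]
    refine (ih _).trans ?_
    refine mul_le_mul_of_nonneg_right ?_ (List.prod_nonneg fun a ha => ?_)
    · rw [rotVar, ← Matrix.mul_assoc,
        hsNorm_mul_of_mul_conjTranspose_eq_one _ (unitary_mul_conjTranspose _)]
      exact (hsNorm_mul_le _ _).trans (le_of_eq (by rw [hsNorm_pad h]))
    · obtain ⟨b, _, rfl⟩ := List.mem_map.1 ha
      exact hsNorm_nonneg _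

lemma prod_map_sort {M : Type*} [CommMonoid M] (S : Finset (Fin m)) (f : Fin m → M) :
    ((S.sort (· ≤ ·)).map f).prod = ∏ i ∈ S, f i := by
  rw [← List.prod_toFinset _ (S.sort_nodup _), Finset.sort_toFinset]

lemma NCPoly.hsNorm_term_le (Q : NCPoly n m) (h : n ≤ p)
    (x : (Fin m → Matrix (Fin n) (Fin n) ℂ) × (Fin m → Matrix.unitaryGroup (Fin p) ℂ))
    (S : Finset (Fin m)) :
    hsNorm (Q.term p x S) ≤ hsNorm (Q S) * ∏ i ∈ S, hsNorm (x.1 i) := by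
  refine (hsNorm_mul_prod_rotVar_le h x.1 x.2 _ _).trans (le_of_eq ?_)
  rw [hsNorm_pad h, prod_map_sort]

lemma hsNorm_mul_prod_ofFn_le {N : ℕ} (B : Matrix (Fin N) (Fin N) ℂ)
    (A : Fin K → Matrix (Fin N) (Fin N) ℂ) :
    hsNorm (B * (List.ofFn A).prod) ≤ hsNorm B * ∏ j, hsNorm (A j) := by
  induction K generalizing B with
  | zero => simp
  | succ K ih =>
    rw [List.ofFn_succ, List.prod_cons, ← Matrix.mul_assoc, Fin.prod_univ_succ, ← mul_assoc]
    refine (ih _ _).trans (mul_le_mul_of_nonneg_right (hsNorm_mul_le _ _) ?_)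
    exact Finset.prod_nonneg fun _ _ => hsNorm_nonneg _

lemma pad_one_mul_term (Q : NCPoly n m) (h : n ≤ p)
    (x : (Fin m → Matrix (Fin n) (Fin n) ℂ) × (Fin m → Matrix.unitaryGroup (Fin p) ℂ))
    (S : Finset (Fin m)) : pad p (1 : Matrix (Fin n) (Fin n) ℂ) * Q.term p x S = Q.term p x S := by
  rw [NCPoly.term, ← Matrix.mul_assoc, pad_mul_pad h, Matrix.one_mul]

lemma NCPoly.norm_wordTrace_le (Q : NCPoly n m) (h : n ≤ p) (hK : 1 ≤ K)
    (x : (Fin m → Matrix (Fin n) (Fin n) ℂ) × (Fin m → Matrix.unitaryGroup (Fin p) ℂ))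
    (s t : Fin K → Finset (Fin m)) :
    ‖Q.wordTrace p x s t‖ ≤ n * ∏ j, hsNorm (Q.term p x (s j) * (Q.term p x (t j))ᴴ) := by
  obtain ⟨k, rfl⟩ : ∃ k, K = k + 1 := ⟨K - 1, by omega⟩
  have e : Q.wordTrace p x s t = trace (pad p (1 : Matrix (Fin n) (Fin n) ℂ) *
      ((pad p (1 : Matrix (Fin n) (Fin n) ℂ)) *
        (List.ofFn fun j => Q.term p x (s j) * (Q.term p x (t j))ᴴ).prod)) := by
    rw [← Matrix.mul_assoc, pad_mul_pad h, Matrix.one_mul, NCPoly.wordTrace, List.ofFn_succ,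
      List.prod_cons, ← Matrix.mul_assoc, ← Matrix.mul_assoc, pad_one_mul_term Q h]
  have h1 : hsNorm (pad p (1 : Matrix (Fin n) (Fin n) ℂ)) = √n := by
    rw [hsNorm_pad h, hsNorm_one, Fintype.card_fin]
  rw [e]
  refine (norm_trace_mul_le _ _).trans ?_
  calc _ ≤ √n * (√n * ∏ j, hsNorm (Q.term p x (s j) * (Q.term p x (t j))ᴴ)) := by
        rw [h1]
        refine mul_le_mul_of_nonneg_left ?_ (Real.sqrt_nonneg _)
        refine (hsNorm_mul_prod_ofFn_le _ _).trans (le_of_eq (by rw [h1]))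
    _ = _ := by rw [← mul_assoc, Real.mul_self_sqrt (Nat.cast_nonneg n)]

lemma NCPoly.norm_wordTrace_le_prod_mul_prod (Q : NCPoly n m) (h : n ≤ p) (hK : 1 ≤ K)
    (x : (Fin m → Matrix (Fin n) (Fin n) ℂ) × (Fin m → Matrix.unitaryGroup (Fin p) ℂ))
    (s t : Fin K → Finset (Fin m)) :
    ‖Q.wordTrace p x s t‖
      ≤ n * ((∏ j, hsNorm (Q.term p x (s j))) * ∏ j, hsNorm (Q.term p x (t j))) := by
  refine (Q.norm_wordTrace_le h hK x s t).trans (mul_le_mul_of_nonneg_left ?_ (Nat.cast_nonneg n))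
  rw [← Finset.prod_mul_distrib]
  refine Finset.prod_le_prod (fun _ _ => hsNorm_nonneg _) fun j _ => ?_
  exact (hsNorm_mul_le _ _).trans (le_of_eq (by rw [hsNorm_conjTranspose]))

lemma prod_prod_eq_prod_pow_mult (g : Fin m → ℝ) (s : Fin K → Finset (Fin m)) :
    ∏ j, ∏ i ∈ s j, g i = ∏ i, g i ^ mult s i := by
  have : ∀ j, ∏ i ∈ s j, g i = ∏ i, if i ∈ s j then g i else 1 := by
    intro j; rw [Finset.prod_ite_mem, Finset.univ_inter]
  simp only [this]
  rw [Finset.prod_comm]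
  refine Finset.prod_congr rfl fun i _ => ?_
  rw [Finset.prod_ite, Finset.prod_const, Finset.prod_const_one, mul_one, mult]

lemma mult_le (s : Fin K → Finset (Fin m)) (i : Fin m) : mult s i ≤ K := by
  simpa [mult] using Finset.card_filter_le (Finset.univ : Finset (Fin K)) fun j => i ∈ s j

lemma NCPoly.prod_hsNorm_term_le (Q : NCPoly n m) (h : n ≤ p)
    (x : (Fin m → Matrix (Fin n) (Fin n) ℂ) × (Fin m → Matrix.unitaryGroup (Fin p) ℂ))
    (s : Fin K → Finset (Fin m)) :
    ∏ j, hsNorm (Q.term p x (s j))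
      ≤ (∏ j, hsNorm (Q (s j))) * ∏ i, hsNorm (x.1 i) ^ mult s i := by
  rw [← prod_prod_eq_prod_pow_mult, ← Finset.prod_mul_distrib]
  exact Finset.prod_le_prod (fun _ _ => hsNorm_nonneg _) fun j _ => Q.hsNorm_term_le h x _

variable {ν : Measure (Matrix (Fin n) (Fin n) ℂ)} [IsProbabilityMeasure ν]

instance inputLaw_isProbabilityMeasure : IsProbabilityMeasure (inputLaw m p ν) := by
  unfold inputLaw; infer_instance

lemma pow_le_one_add_pow {a : ℝ} (ha : 0 ≤ a) {r q : ℕ} (h : r ≤ q) : a ^ r ≤ 1 + a ^ q := by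
  rcases le_total a 1 with h1 | h1
  · exact (pow_le_one₀ ha h1).trans (le_add_of_nonneg_right (pow_nonneg ha _))
  · exact (pow_le_pow_right₀ h1 h).trans (le_add_of_nonneg_left zero_le_one)

lemma NCPoly.integrable_wordTrace (Q : NCPoly n m) (h : n ≤ p) (hK : 1 ≤ K)
    (hi : MatIntegrable ν fun G => (G * Gᴴ) ^ K) (s t : Fin K → Finset (Fin m)) :
    Integrable (fun x => Q.wordTrace p x s t) (inputLaw m p ν) := by
  have h1 : Integrable (fun G : Fin m → Matrix (Fin n) (Fin n) ℂ => ∏ i, (1 + hsSq (G i) ^ K))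
      (Measure.pi fun _ : Fin m => ν) :=
    Integrable.fintype_prod (f := fun _ G => 1 + hsSq G ^ K)
      fun _ => (integrable_const _).add (integrable_hsSq_pow hK hi)
  have h2 : Integrable (fun x : (Fin m → Matrix (Fin n) (Fin n) ℂ) ×
      (Fin m → Matrix.unitaryGroup (Fin p) ℂ) => ∏ i, (1 + hsSq (x.1 i) ^ K)) (inputLaw m p ν) :=
    h1.comp_fst _
  refine Integrable.mono' (h2.const_mul
    (n * ((∏ j, hsNorm (Q (s j))) * ∏ j, hsNorm (Q (t j)))))
    (Q.continuous_wordTrace s t).measurable.aestronglyMeasurable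
    (Filter.Eventually.of_forall fun x => ?_)
  refine (Q.norm_wordTrace_le_prod_mul_prod h hK x s t).trans ?_
  rw [mul_assoc]
  refine mul_le_mul_of_nonneg_left ?_ (Nat.cast_nonneg n)
  refine (mul_le_mul (Q.prod_hsNorm_term_le h x s) (Q.prod_hsNorm_term_le h x t)
    (Finset.prod_nonneg fun _ _ => hsNorm_nonneg _) ?_).trans ?_
  · exact mul_nonneg (Finset.prod_nonneg fun _ _ => hsNorm_nonneg _)
      (Finset.prod_nonneg fun _ _ => pow_nonneg (hsNorm_nonneg _) _)
  rw [mul_mul_mul_comm]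
  refine mul_le_mul_of_nonneg_left ?_ (mul_nonneg (Finset.prod_nonneg fun _ _ => hsNorm_nonneg _)
    (Finset.prod_nonneg fun _ _ => hsNorm_nonneg _))
  rw [← Finset.prod_mul_distrib]
  refine Finset.prod_le_prod (fun i _ => ?_) fun i _ => ?_
  · exact mul_nonneg (pow_nonneg (hsNorm_nonneg _) _) (pow_nonneg (hsNorm_nonneg _) _)
  · rw [← pow_add, ← hsNorm_sq, ← pow_mul]
    refine pow_le_one_add_pow (hsNorm_nonneg _) ?_
    have := mult_le s i
    have := mult_le t i
    omega

/-! ### Phase invariance -/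

lemma prod_ofFn_smul {N : ℕ} (a : Fin K → ℂ) (A : Fin K → Matrix (Fin N) (Fin N) ℂ) :
    (List.ofFn fun j => a j • A j).prod = (∏ j, a j) • (List.ofFn A).prod := by
  induction K with
  | zero => simp
  | succ K ih =>
    rw [List.ofFn_succ, List.prod_cons, ih, List.ofFn_succ, List.prod_cons, Fin.prod_univ_succ,
      smul_mul_smul_comm]

lemma prod_map_smul {N : ℕ} (a : Fin m → ℂ) (A : Fin m → Matrix (Fin N) (Fin N) ℂ)
    (l : List (Fin m)) :
    (l.map fun i => a i • A i).prod = (l.map a).prod • (l.map A).prod := by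
  induction l with
  | nil => simp
  | cons i l ih => simp only [List.map_cons, List.prod_cons, ih, smul_mul_smul_comm]

/-- A scalar of modulus one, as a unitary matrix. -/
noncomputable def scalarUnitary (p : ℕ) (z : ℂ) (hz : ‖z‖ = 1) : Matrix.unitaryGroup (Fin p) ℂ :=
  ⟨z • 1, by
    rw [Matrix.mem_unitaryGroup_iff, star_smul, star_one, smul_mul_smul_comm, Matrix.one_mul]
    have : z * star z = 1 := by
      have := Complex.mul_conj z
      rw [Complex.normSq_eq_norm_sq, hz] at this
      simpa using this
    rw [this, one_smul]⟩

lemma NCPoly.wordTrace_phase (Q : NCPoly n m) (i : Fin m) {z : ℂ} (hz : ‖z‖ = 1)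
    (G : Fin m → Matrix (Fin n) (Fin n) ℂ) (H : Fin m → Matrix.unitaryGroup (Fin p) ℂ)
    (s t : Fin K → Finset (Fin m)) :
    Q.wordTrace p (G, Pi.mulSingle i (scalarUnitary p z hz) * H) s t
      = (z ^ mult s i * (star z) ^ mult t i) * Q.wordTrace p (G, H) s t := by
  have h1 : ∀ S, Q.term p (G, Pi.mulSingle i (scalarUnitary p z hz) * H) S
      = (if i ∈ S then z else 1) • Q.term p (G, H) S := by
    intro S
    have e : rotVar p G (Pi.mulSingle i (scalarUnitary p z hz) * H)
        = fun a => (if a = i then z else 1) • rotVar p G H a := by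
      funext a
      by_cases ha : a = i
      · subst ha
        simp [rotVar, scalarUnitary]
      · simp [rotVar, ha]
    rw [NCPoly.term, NCPoly.term, e, prod_map_smul, Matrix.mul_smul, prod_map_sort]
    congr 1
    rw [Finset.prod_ite_eq']
  rw [NCPoly.wordTrace, NCPoly.wordTrace]
  simp only [h1, conjTranspose_smul, smul_mul_smul_comm]
  rw [prod_ofFn_smul, trace_smul, smul_eq_mul, Finset.prod_mul_distrib, mult, mult]
  congr 2
  · rw [Finset.prod_ite, Finset.prod_const, Finset.prod_const_one, mul_one]
  · have : ∀ j, star (if i ∈ t j then z else 1) = if i ∈ t j then star z else 1 := by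
      intro j; split_ifs <;> simp
    simp only [this]
    rw [Finset.prod_ite, Finset.prod_const, Finset.prod_const_one, mul_one]

/-- Phase invariance of Haar measure annihilates every word in which some variable and its adjoint
occur with different multiplicities. -/
lemma NCPoly.integral_wordTrace_eq_zero (Q : NCPoly n m) (h : n ≤ p) (hK : 1 ≤ K)
    (hi : MatIntegrable ν fun G => (G * Gᴴ) ^ K) {s t : Fin K → Finset (Fin m)}
    (hst : mult s ≠ mult t) : ∫ x, Q.wordTrace p x s t ∂(inputLaw m p ν) = 0 := by
  obtain ⟨i, hi'⟩ := Function.ne_iff.1 hst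
  have hne : ((mult s i : ℂ) - mult t i) ≠ 0 := sub_ne_zero.2 (by exact_mod_cast hi')
  set z : ℂ := Complex.exp (((Real.pi / (mult s i - mult t i) : ℝ) : ℂ) * Complex.I) with hzdef
  have hz : ‖z‖ = 1 := Complex.norm_exp_ofReal_mul_I _
  -- the phase is chosen so that the word changes sign
  have hfac : z ^ mult s i * (star z) ^ mult t i = -1 := by
    have hs : star z = Complex.exp (-(((Real.pi / (mult s i - mult t i) : ℝ) : ℂ) * Complex.I)) := by
      rw [hzdef]
      change (starRingEnd ℂ) _ = _
      rw [← Complex.exp_conj]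
      simp
    rw [hs, hzdef, ← Complex.exp_nat_mul, ← Complex.exp_nat_mul, ← Complex.exp_add,
      ← Complex.exp_pi_mul_I]
    congr 1
    push_cast
    field_simp
    ring
  have hint := Q.integrable_wordTrace (p := p) h hK hi s t
  rw [inputLaw] at hint ⊢
  rw [integral_prod _ hint]
  refine integral_eq_zero_of_ae (Filter.Eventually.of_forall fun G => ?_)
  have h1 := integral_mul_left_eq_self (μ := Measure.pi fun _ : Fin m => haarUnitary p)
    (fun H => Q.wordTrace p (G, H) s t) (Pi.mulSingle i (scalarUnitary p z hz))
  simp only [Q.wordTrace_phase, hfac] at h1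
  rw [integral_const_mul] at h1
  have : (2 : ℂ) * ∫ H, Q.wordTrace p (G, H) s t ∂(Measure.pi fun _ : Fin m => haarUnitary p) = 0 := by
    linear_combination -h1
  simpa using this

end WordTrace

section WordBound
variable {n m p K d : ℕ} {ν : Measure (Matrix (Fin n) (Fin n) ℂ)} [IsProbabilityMeasure ν] {c : ℝ}

/-- The inequality of arithmetic and geometric means. -/
lemma prod_le_sum_pow_div (hK : 1 ≤ K) {u : Fin K → ℝ} (hu : ∀ j, 0 ≤ u j) :
    ∏ j, u j ≤ ∑ j, (1 / (K : ℝ)) * u j ^ K := by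
  have hK' : (K : ℝ) ≠ 0 := by positivity
  have := Real.geom_mean_le_arith_mean_weighted Finset.univ (fun _ : Fin K => 1 / (K : ℝ))
    (fun j => u j ^ K) (fun _ _ => by positivity) (by simp [hK']) (fun j _ => pow_nonneg (hu j) K)
  refine le_trans (le_of_eq (Finset.prod_congr rfl fun j _ => ?_)) this
  rw [one_div, Real.pow_rpow_inv_natCast (hu j) (by omega)]

lemma NCPoly.integral_hsSq_term_pow_le (Q : NCPoly n m) (h : n ≤ p) (hK : 1 ≤ K) (hc0 : 0 ≤ c)
    (hi : MatIntegrable ν fun G => (G * Gᴴ) ^ K)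
    (hc : opNorm (matExpect ν fun G => (G * Gᴴ) ^ K) ≤ c) (S : Finset (Fin m)) :
    Integrable (fun x => hsSq (Q.term p x S) ^ K) (inputLaw m p ν) ∧
      ∫ x, hsSq (Q.term p x S) ^ K ∂(inputLaw m p ν) ≤ c ^ S.card * hsSq (Q S) ^ K := by
  have hnn : ∀ x, 0 ≤ hsSq (Q.term p x S) ^ K := fun x => pow_nonneg (hsSq_nonneg _) _
  have hmeas : Measurable fun x => hsSq (Q.term p x S) ^ K :=
    (continuous_hsSq.comp (Q.continuous_term S)).measurable.pow_const K
  have hb : 0 ≤ c ^ S.card * hsSq (Q S) ^ K := mul_nonneg (pow_nonneg hc0 _)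
    (pow_nonneg (hsSq_nonneg _) _)
  have key : ∫⁻ x, ENNReal.ofReal (hsSq (Q.term p x S) ^ K) ∂(inputLaw m p ν)
      ≤ ENNReal.ofReal (c ^ S.card * hsSq (Q S) ^ K) := by
    rw [inputLaw, lintegral_prod_symm _ hmeas.ennreal_ofReal.aemeasurable]
    calc _ ≤ ∫⁻ _H : Fin m → Matrix.unitaryGroup (Fin p) ℂ,
          ENNReal.ofReal (c ^ S.card * hsSq (Q S) ^ K) ∂(Measure.pi fun _ => haarUnitary p) := by
          refine lintegral_mono fun H => ?_
          refine (lintegral_hsSq_mul_prod_le h hK hc0 hi hc H (S.sort_nodup (· ≤ ·))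
            (pad p (Q S))).trans (le_of_eq ?_)
          rw [Finset.length_sort, ← hsNorm_sq, hsNorm_pad h, hsNorm_sq]
      _ = _ := by simp
  have hint : Integrable (fun x => hsSq (Q.term p x S) ^ K) (inputLaw m p ν) := by
    refine ⟨hmeas.aestronglyMeasurable, ?_⟩
    rw [hasFiniteIntegral_iff_ofReal (Filter.Eventually.of_forall hnn)]
    exact key.trans_lt ENNReal.ofReal_lt_top
  refine ⟨hint, ?_⟩
  rw [← ofReal_integral_eq_lintegral_ofReal hint (Filter.Eventually.of_forall hnn)] at key
  exact (ENNReal.ofReal_le_ofReal_iff hb).1 key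

lemma NCPoly.integral_prod_hsSq_term_le (Q : NCPoly n m) (h : n ≤ p) (hK : 1 ≤ K) (hc1 : 1 ≤ c)
    (hi : MatIntegrable ν fun G => (G * Gᴴ) ^ K)
    (hc : opNorm (matExpect ν fun G => (G * Gᴴ) ^ K) ≤ c)
    (hd : ∀ S, Q S ≠ 0 → S.card ≤ d) (s : Fin K → Finset (Fin m)) :
    Integrable (fun x => ∏ j, hsSq (Q.term p x (s j))) (inputLaw m p ν) ∧
      ∫ x, ∏ j, hsSq (Q.term p x (s j)) ∂(inputLaw m p ν) ≤ c ^ d * ∏ j, hsSq (Q (s j)) := by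
  have hK' : (K : ℝ) ≠ 0 := by positivity
  have hc0 : 0 ≤ c := zero_le_one.trans hc1
  -- the moments are normalized by the weights `hsSq (Q (s j))`, so these must not vanish
  by_cases h0 : ∃ j, hsSq (Q (s j)) = 0
  · obtain ⟨j, hj⟩ := h0
    have hz : ∀ x, ∏ j, hsSq (Q.term p x (s j)) = 0 := by
      intro x
      refine Finset.prod_eq_zero (Finset.mem_univ j) ?_
      have : pad p (0 : Matrix (Fin n) (Fin n) ℂ) = 0 := by simp [pad_eq]
      rw [NCPoly.term, eq_zero_of_hsSq_eq_zero hj, this, Matrix.zero_mul]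
      simp [hsSq]
    simp only [hz]
    refine ⟨integrable_zero _ _ _, ?_⟩
    rw [integral_zero]
    exact mul_nonneg (pow_nonneg hc0 _) (Finset.prod_nonneg fun _ _ => hsSq_nonneg _)
  push Not at h0
  set W : ℝ := ∏ j, hsSq (Q (s j)) with hW
  have hW0 : 0 ≤ W := Finset.prod_nonneg fun _ _ => hsSq_nonneg _
  have hpt : ∀ x, ∏ j, hsSq (Q.term p x (s j))
      ≤ W * ∑ j, (1 / (K : ℝ)) * (hsSq (Q.term p x (s j)) ^ K * (hsSq (Q (s j)) ^ K)⁻¹) := by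
    intro x
    have h1 := prod_le_sum_pow_div hK (u := fun j => hsSq (Q.term p x (s j)) / hsSq (Q (s j)))
      fun j => div_nonneg (hsSq_nonneg _) (hsSq_nonneg _)
    calc ∏ j, hsSq (Q.term p x (s j))
        = W * ∏ j, hsSq (Q.term p x (s j)) / hsSq (Q (s j)) := by
          rw [hW, ← Finset.prod_mul_distrib]
          exact Finset.prod_congr rfl fun j _ => (mul_div_cancel₀ _ (h0 j)).symm
      _ ≤ _ := by
          refine mul_le_mul_of_nonneg_left (h1.trans (le_of_eq ?_)) hW0
          exact Finset.sum_congr rfl fun j _ => by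
            rw [div_pow, div_eq_mul_inv (_ ^ K)]
  have hI : ∀ j, Integrable (fun x => (1 / (K : ℝ)) *
      (hsSq (Q.term p x (s j)) ^ K * (hsSq (Q (s j)) ^ K)⁻¹)) (inputLaw m p ν) := fun j =>
    ((Q.integral_hsSq_term_pow_le h hK hc0 hi hc (s j)).1.mul_const _).const_mul _
  have hI' := (integrable_finsetSum Finset.univ fun j _ => hI j).const_mul W
  have hmeas : Measurable fun x => ∏ j, hsSq (Q.term p x (s j)) :=
    Finset.measurable_prod _ fun j _ =>
      (continuous_hsSq.comp (Q.continuous_term (s j))).measurable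
  have hnn : ∀ x, 0 ≤ ∏ j, hsSq (Q.term p x (s j)) := fun x =>
    Finset.prod_nonneg fun _ _ => hsSq_nonneg _
  have hint : Integrable (fun x => ∏ j, hsSq (Q.term p x (s j))) (inputLaw m p ν) :=
    hI'.mono' hmeas.aestronglyMeasurable (Filter.Eventually.of_forall fun x => by
      rw [Real.norm_of_nonneg (hnn x)]; exact hpt x)
  refine ⟨hint, (integral_mono hint hI' hpt).trans ?_⟩
  rw [integral_const_mul, integral_finsetSum _ fun j _ => hI j, mul_comm]
  refine mul_le_mul_of_nonneg_right ?_ hW0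
  calc _ ≤ ∑ _j : Fin K, (1 / (K : ℝ)) * c ^ d := by
        refine Finset.sum_le_sum fun j _ => ?_
        rw [integral_const_mul, integral_mul_const]
        refine mul_le_mul_of_nonneg_left ?_ (by positivity)
        have hpos : 0 < hsSq (Q (s j)) ^ K :=
          pow_pos ((hsSq_nonneg _).lt_of_ne (h0 j).symm) _
        rw [← div_eq_mul_inv, div_le_iff₀ hpos]
        refine (Q.integral_hsSq_term_pow_le h hK hc0 hi hc (s j)).2.trans ?_
        refine mul_le_mul_of_nonneg_right (pow_le_pow_right₀ hc1 (hd _ fun e => h0 j ?_)) hpos.le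
        simp [e, hsSq]
    _ = _ := by
        rw [Finset.sum_const, Finset.card_univ, Fintype.card_fin, nsmul_eq_mul]
        field_simp

/-- Hypercontractive bound for the words whose multiplicities satisfy `P`. -/
lemma NCPoly.sum_wordTrace_le (Q : NCPoly n m) (h : n ≤ p) (hK : 1 ≤ K) (hc1 : 1 ≤ c)
    (hi : MatIntegrable ν fun G => (G * Gᴴ) ^ K)
    (hc : opNorm (matExpect ν fun G => (G * Gᴴ) ^ K) ≤ c)
    (hd : ∀ S, Q S ≠ 0 → S.card ≤ d) (P : (Fin m → ℕ) → Prop) [DecidablePred P] :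
    ∑ s : Fin K → Finset (Fin m), ∑ t : Fin K → Finset (Fin m),
        (if P (mult s) ∧ mult s = mult t then
          (∫ x, Q.wordTrace p x s t ∂(inputLaw m p ν)).re else 0)
      ≤ n * ((K : ℝ) ^ (d * K) * (c ^ d *
          ∑ s : Fin K → Finset (Fin m), if P (mult s) then ∏ j, hsSq (Q (s j)) else 0)) := by
  have hword := fun s t : Fin K → Finset (Fin m) => Q.integrable_wordTrace (p := p) h hK hi s t
  have hJ : ∀ s t : Fin K → Finset (Fin m), Integrable (fun x =>
      if P (mult s) ∧ mult s = mult t then ‖Q.wordTrace p x s t‖ else 0) (inputLaw m p ν) := by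
    intro s t
    split_ifs
    · exact (hword s t).norm
    · exact integrable_zero _ _ _
  have hR : ∀ s : Fin K → Finset (Fin m), Integrable (fun x =>
      if P (mult s) then ∏ j, hsSq (Q.term p x (s j)) else 0) (inputLaw m p ν) := by
    intro s
    split_ifs
    · exact (Q.integral_prod_hsSq_term_le h hK hc1 hi hc hd s).1
    · exact integrable_zero _ _ _
  have hpt : ∀ x, ∑ s : Fin K → Finset (Fin m), ∑ t : Fin K → Finset (Fin m),
        (if P (mult s) ∧ mult s = mult t then ‖Q.wordTrace p x s t‖ else 0)
      ≤ n * ((K : ℝ) ^ (d * K) * ∑ s : Fin K → Finset (Fin m),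
        if P (mult s) then ∏ j, hsSq (Q.term p x (s j)) else 0) := by
    intro x
    have h1 := sum_mult_eq_le (K := K) (d := d) P (fun S => hsNorm (Q.term p x S)) (by
      intro S hS
      refine hd S fun e => hS ?_
      have : pad p (0 : Matrix (Fin n) (Fin n) ℂ) = 0 := by simp [pad_eq]
      rw [NCPoly.term, e, this, Matrix.zero_mul, hsNorm_zero])
    simp only [hsNorm_sq] at h1
    refine le_trans ?_ (mul_le_mul_of_nonneg_left h1 (Nat.cast_nonneg n))
    rw [Finset.mul_sum]
    refine Finset.sum_le_sum fun s _ => ?_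
    rw [Finset.mul_sum]
    refine Finset.sum_le_sum fun t _ => ?_
    split_ifs
    · exact Q.norm_wordTrace_le_prod_mul_prod h hK x s t
    · simp
  calc _ ≤ ∑ s : Fin K → Finset (Fin m), ∑ t : Fin K → Finset (Fin m),
        ∫ x, (if P (mult s) ∧ mult s = mult t then ‖Q.wordTrace p x s t‖ else 0)
          ∂(inputLaw m p ν) := by
        refine Finset.sum_le_sum fun s _ => Finset.sum_le_sum fun t _ => ?_
        split_ifs
        · exact (Complex.re_le_norm _).trans (norm_integral_le_integral_norm _)
        · simp
    _ = ∫ x, ∑ s : Fin K → Finset (Fin m), ∑ t : Fin K → Finset (Fin m),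
        (if P (mult s) ∧ mult s = mult t then ‖Q.wordTrace p x s t‖ else 0)
          ∂(inputLaw m p ν) := by
        rw [integral_finsetSum _ fun s _ => integrable_finsetSum _ fun t _ => hJ s t]
        exact Finset.sum_congr rfl fun s _ => (integral_finsetSum _ fun t _ => hJ s t).symm
    _ ≤ ∫ x, n * ((K : ℝ) ^ (d * K) * ∑ s : Fin K → Finset (Fin m),
        if P (mult s) then ∏ j, hsSq (Q.term p x (s j)) else 0) ∂(inputLaw m p ν) :=
        integral_mono (integrable_finsetSum _ fun s _ => integrable_finsetSum _ fun t _ => hJ s t)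
          (((integrable_finsetSum _ fun s _ => hR s).const_mul _).const_mul _) hpt
    _ ≤ _ := by
        rw [integral_const_mul, integral_const_mul, integral_finsetSum _ fun s _ => hR s]
        refine mul_le_mul_of_nonneg_left (mul_le_mul_of_nonneg_left ?_ (by positivity))
          (Nat.cast_nonneg n)
        rw [Finset.mul_sum]
        refine Finset.sum_le_sum fun s _ => ?_
        split_ifs
        · exact (Q.integral_prod_hsSq_term_le h hK hc1 hi hc hd s).2
        · simp

end WordBound

/-! ### Diagonal words -/

section Diagonal
variable {n m p K : ℕ} {ν : Measure (Matrix (Fin n) (Fin n) ℂ)} [IsProbabilityMeasure ν]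

lemma integrable_pi_mul {E : Type*} [MeasurableSpace E] {μ : Measure E} [IsProbabilityMeasure μ]
    (i : Fin m) {a : E → ℂ} {g : (Fin m → E) → ℂ} (ha : Integrable a μ) (ham : Measurable a)
    (hg : Integrable g (Measure.pi fun _ : Fin m => μ)) (hgm : Measurable g)
    (hgi : ∀ x y, g (Function.update x i y) = g x) :
    Integrable (fun x => a (x i) * g x) (Measure.pi fun _ : Fin m => μ) := by
  have h := measurePreserving_update (m := m) μ i
  have hf : Measurable fun x : Fin m → E => a (x i) * g x :=
    (ham.comp (measurable_pi_apply i)).mul hgm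
  rw [← h.map_eq, integrable_map_measure hf.aestronglyMeasurable h.measurable.aemeasurable]
  refine (ha.mul_prod hg).congr (Filter.Eventually.of_forall fun q => ?_)
  simp [hgi]

lemma integral_mul_mul_apply {μ : Measure (Matrix (Fin n) (Fin n) ℂ)}
    {X : Matrix (Fin n) (Fin n) ℂ → Matrix (Fin n) (Fin n) ℂ}
    (hX : MatIntegrable μ X) (A B : Matrix (Fin n) (Fin n) ℂ) (a b : Fin n) :
    Integrable (fun y => (A * X y * B) a b) μ ∧
      ∫ y, (A * X y * B) a b ∂μ = (A * matExpect μ X * B) a b := by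
  have e : ∀ Z : Matrix (Fin n) (Fin n) ℂ, (A * Z * B) a b
      = ∑ j, ∑ i, A a i * Z i j * B j b := by
    intro Z
    simp [mul_apply, Finset.sum_mul]
  have hi : ∀ j i, Integrable (fun y => A a i * X y i j * B j b) μ := fun j i =>
    ((hX i j).const_mul _).mul_const _
  simp only [e]
  refine ⟨integrable_finsetSum _ fun j _ => integrable_finsetSum _ fun i _ => hi j i, ?_⟩
  rw [integral_finsetSum _ fun j _ => integrable_finsetSum _ fun i _ => hi j i]
  refine Finset.sum_congr rfl fun j _ => ?_
  rw [integral_finsetSum _ fun i _ => hi j i]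
  refine Finset.sum_congr rfl fun i _ => ?_
  rw [integral_mul_const, integral_const_mul]
  rfl

/-- The unpadded matrix `Q S * G S`, without the unitary factors. -/
noncomputable def NCPoly.bareTerm (Q : NCPoly n m) (G : Fin m → Matrix (Fin n) (Fin n) ℂ)
    (S : Finset (Fin m)) : Matrix (Fin n) (Fin n) ℂ := Q S * ((S.sort (· ≤ ·)).map G).prod

lemma NCPoly.bareTerm_empty (Q : NCPoly n m) (G : Fin m → Matrix (Fin n) (Fin n) ℂ) :
    Q.bareTerm G ∅ = Q ∅ := by simp [NCPoly.bareTerm]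

lemma NCPoly.bareTerm_singleton (Q : NCPoly n m) (G : Fin m → Matrix (Fin n) (Fin n) ℂ)
    (i : Fin m) : Q.bareTerm G {i} = Q {i} * G i := by simp [NCPoly.bareTerm]

lemma NCPoly.continuous_bareTerm (Q : NCPoly n m) (S : Finset (Fin m)) :
    Continuous fun G => Q.bareTerm G S :=
  Continuous.matrix_mul continuous_const (continuous_list_prod _ fun i _ => continuous_apply i)

lemma NCPoly.bareTerm_update (Q : NCPoly n m) {S : Finset (Fin m)} {i : Fin m} (hi : i ∉ S)
    (G : Fin m → Matrix (Fin n) (Fin n) ℂ) (y : Matrix (Fin n) (Fin n) ℂ) :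
    Q.bareTerm (Function.update G i y) S = Q.bareTerm G S := by
  rw [NCPoly.bareTerm, NCPoly.bareTerm]
  congr 2
  refine List.map_congr_left fun a ha => Function.update_of_ne ?_ _ _
  rintro rfl
  exact hi ((Finset.mem_sort _).1 ha)

lemma measurable_conj_apply (A B : Matrix (Fin n) (Fin n) ℂ) (a b : Fin n) :
    Measurable fun y : Matrix (Fin n) (Fin n) ℂ => (A * (y * yᴴ) * B) a b := by
  have : Continuous fun y : Matrix (Fin n) (Fin n) ℂ => A * (y * yᴴ) * B :=
    Continuous.matrix_mul (Continuous.matrix_mul continuous_const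
      (Continuous.matrix_mul continuous_id continuous_id.matrix_conjTranspose)) continuous_const
  exact (this.matrix_elem a b).measurable

lemma NCPoly.term_empty (Q : NCPoly n m)
    (x : (Fin m → Matrix (Fin n) (Fin n) ℂ) × (Fin m → Matrix.unitaryGroup (Fin p) ℂ)) :
    Q.term p x ∅ = pad p (Q ∅) := by simp [NCPoly.term]

lemma NCPoly.term_singleton (Q : NCPoly n m) (h : n ≤ p)
    (x : (Fin m → Matrix (Fin n) (Fin n) ℂ) × (Fin m → Matrix.unitaryGroup (Fin p) ℂ)) (i : Fin m) :
    Q.term p x {i} = pad p (Q {i} * x.1 i) * (x.2 i : Matrix (Fin p) (Fin p) ℂ) := by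
  simp only [NCPoly.term, Finset.sort_singleton, List.map_cons, List.map_nil, List.prod_cons,
    List.prod_nil, mul_one, rotVar]
  rw [← Matrix.mul_assoc, pad_mul_pad h]

lemma card_le_one_cases {S : Finset (Fin m)} (h : S.card ≤ 1) : S = ∅ ∨ ∃ i, S = {i} := by
  rcases Nat.le_one_iff_eq_zero_or_eq_one.1 h with h | h
  · exact Or.inl (Finset.card_eq_zero.1 h)
  · exact Or.inr (Finset.card_eq_one.1 h)

lemma NCPoly.term_mul_conjTranspose (Q : NCPoly n m) (h : n ≤ p)
    (x : (Fin m → Matrix (Fin n) (Fin n) ℂ) × (Fin m → Matrix.unitaryGroup (Fin p) ℂ))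
    {S : Finset (Fin m)} (hS : S.card ≤ 1) :
    Q.term p x S * (Q.term p x S)ᴴ = pad p (Q.bareTerm x.1 S * (Q.bareTerm x.1 S)ᴴ) := by
  rcases card_le_one_cases hS with rfl | ⟨i, rfl⟩
  · rw [Q.bareTerm_empty, Q.term_empty, pad_conjTranspose, pad_mul_pad h]
  · rw [Q.bareTerm_singleton]
    rw [Q.term_singleton h, conjTranspose_mul, Matrix.mul_assoc, 
      ← Matrix.mul_assoc (x.2 i : Matrix (Fin p) (Fin p) ℂ),
      unitary_mul_conjTranspose, Matrix.one_mul, pad_conjTranspose, pad_mul_pad h]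

lemma prod_ofFn_pad (h : n ≤ p) (hK : 1 ≤ K) (A : Fin K → Matrix (Fin n) (Fin n) ℂ) :
    (List.ofFn fun j => pad p (A j)).prod = pad p (List.ofFn A).prod := by
  induction K, hK using Nat.le_induction with
  | base => simp
  | succ K hK ih =>
    rw [List.ofFn_succ, List.prod_cons, ih, List.ofFn_succ, List.prod_cons, pad_mul_pad h]

/-- In a diagonal word without repeated indices the factors are independent, and each factor
`G i (G i)ᴴ` integrates to the identity. -/
lemma NCPoly.integral_prod_bareTerm (Q : NCPoly n m) (hν : IsNormalizedEnsemble ν)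
    {s : Fin K → Finset (Fin m)} (hs : ∀ j, (s j).card ≤ 1) (hm : ∀ i, mult s i ≤ 1)
    (a b : Fin n) :
    Integrable (fun G => (List.ofFn fun j => Q.bareTerm G (s j) * (Q.bareTerm G (s j))ᴴ).prod a b)
        (Measure.pi fun _ : Fin m => ν) ∧
      ∫ G, (List.ofFn fun j => Q.bareTerm G (s j) * (Q.bareTerm G (s j))ᴴ).prod a b
        ∂(Measure.pi fun _ : Fin m => ν)
        = (List.ofFn fun j => Q (s j) * (Q (s j))ᴴ).prod a b := by
  induction K generalizing a b with
  | zero => simp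
  | succ K ih =>
    have hms : ∀ i, mult s i = (if i ∈ s 0 then 1 else 0) + mult (fun j : Fin K => s j.succ) i := by
      intro i
      simp only [mult, Finset.card_filter]
      exact Fin.sum_univ_succ _
    have ih' := fun c => ih (s := fun j => s j.succ) (fun j => hs j.succ)
      (fun i => (Nat.le_add_left _ _).trans ((hms i).symm.le.trans (hm i))) c b
    have hmeas : ∀ c, Measurable fun G : Fin m → Matrix (Fin n) (Fin n) ℂ =>
        (List.ofFn fun j : Fin K => Q.bareTerm G (s j.succ) * (Q.bareTerm G (s j.succ))ᴴ).prod c b := by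
      intro c
      have : Continuous fun G : Fin m → Matrix (Fin n) (Fin n) ℂ =>
          (List.ofFn fun j : Fin K =>
            Q.bareTerm G (s j.succ) * (Q.bareTerm G (s j.succ))ᴴ).prod :=
        continuous_prod_ofFn fun j => Continuous.matrix_mul (Q.continuous_bareTerm _)
          (Q.continuous_bareTerm _).matrix_conjTranspose
      exact (this.matrix_elem c b).measurable
    simp only [List.ofFn_succ, List.prod_cons, mul_apply (M := _ * _)]
    suffices hc : ∀ c, Integrable (fun G => (Q.bareTerm G (s 0) * (Q.bareTerm G (s 0))ᴴ) a c *
          (List.ofFn fun j : Fin K => Q.bareTerm G (s j.succ) * (Q.bareTerm G (s j.succ))ᴴ).prod c b)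
          (Measure.pi fun _ : Fin m => ν) ∧
        ∫ G, (Q.bareTerm G (s 0) * (Q.bareTerm G (s 0))ᴴ) a c *
          (List.ofFn fun j : Fin K => Q.bareTerm G (s j.succ) * (Q.bareTerm G (s j.succ))ᴴ).prod c b
          ∂(Measure.pi fun _ : Fin m => ν)
        = (Q (s 0) * (Q (s 0))ᴴ) a c *
          (List.ofFn fun j : Fin K => Q (s j.succ) * (Q (s j.succ))ᴴ).prod c b by
      refine ⟨integrable_finsetSum _ fun c _ => (hc c).1, ?_⟩
      rw [integral_finsetSum _ fun c _ => (hc c).1]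
      exact Finset.sum_congr rfl fun c _ => (hc c).2
    intro c
    rcases card_le_one_cases (hs 0) with h0 | ⟨i, h0⟩
    · rw [h0]
      simp only [Q.bareTerm_empty]
      exact ⟨(ih' c).1.const_mul _, by rw [integral_const_mul, (ih' c).2]⟩
    · rw [h0]
      have e : ∀ G : Fin m → Matrix (Fin n) (Fin n) ℂ,
          Q.bareTerm G {i} * (Q.bareTerm G {i})ᴴ = Q {i} * (G i * (G i)ᴴ) * (Q {i})ᴴ := by
        intro G
        rw [Q.bareTerm_singleton, conjTranspose_mul]
        simp only [Matrix.mul_assoc]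
      simp only [e]
      have hA := integral_mul_mul_apply hν.integrable_sq (Q {i}) (Q {i})ᴴ a c
      have hAm := measurable_conj_apply (Q {i}) (Q {i})ᴴ a c
      -- the index `i` does not recur in the rest of the word
      have hnot : ∀ j : Fin K, i ∉ s j.succ := by
        have h1 := hms i
        have h2 := hm i
        simp only [h0, Finset.mem_singleton, if_true] at h1
        have hz : mult (fun j : Fin K => s j.succ) i = 0 := by omega
        intro j hj
        rw [mult, Finset.card_eq_zero, Finset.filter_eq_empty_iff] at hz
        exact hz (Finset.mem_univ j) hj
      have hgi : ∀ (G : Fin m → Matrix (Fin n) (Fin n) ℂ) (y : Matrix (Fin n) (Fin n) ℂ),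
          (List.ofFn fun j : Fin K => Q.bareTerm (Function.update G i y) (s j.succ) *
            (Q.bareTerm (Function.update G i y) (s j.succ))ᴴ).prod c b
          = (List.ofFn fun j : Fin K => Q.bareTerm G (s j.succ) *
            (Q.bareTerm G (s j.succ))ᴴ).prod c b := by
        intro G y
        simp only [Q.bareTerm_update (hnot _)]
      refine ⟨integrable_pi_mul i (a := fun y => (Q {i} * (y * yᴴ) * (Q {i})ᴴ) a c)
        hA.1 hAm (ih' c).1 (hmeas c) hgi, ?_⟩
      have := integral_pi_mul (ν := ν) i (a := fun y => (Q {i} * (y * yᴴ) * (Q {i})ᴴ) a c)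
        hAm (hmeas c) hgi
      rw [this, hA.2, (ih' c).2, hν.second, Matrix.mul_one]

lemma NCPoly.integral_wordTrace_diagonal (Q : NCPoly n m) (h : n ≤ p) (hK : 1 ≤ K)
    (hν : IsNormalizedEnsemble ν) {s : Fin K → Finset (Fin m)} (hs : ∀ j, (s j).card ≤ 1)
    (hm : ∀ i, mult s i ≤ 1) :
    ∫ x, Q.wordTrace p x s s ∂(inputLaw m p ν)
      = trace (List.ofFn fun j => Q (s j) * (Q (s j))ᴴ).prod := by
  have e : ∀ x, Q.wordTrace p x s s = ∑ a,
      (List.ofFn fun j => Q.bareTerm x.1 (s j) * (Q.bareTerm x.1 (s j))ᴴ).prod a a := by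
    intro x
    rw [NCPoly.wordTrace]
    simp only [Q.term_mul_conjTranspose h x (hs _)]
    rw [prod_ofFn_pad h hK, trace_pad h]
    rfl
  simp only [e]
  have hB := fun a => Q.integral_prod_bareTerm hν hs hm a a
  rw [inputLaw, integral_fun_fst
    (f := fun G => ∑ a, (List.ofFn fun j => Q.bareTerm G (s j) * (Q.bareTerm G (s j))ᴴ).prod a a)]
  rw [probReal_univ, one_smul, integral_finsetSum _ fun a _ => (hB a).1]
  exact Finset.sum_congr rfl fun a _ => (hB a).2

end Diagonal

/-! ### Corners of Haar unitaries -/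

section Corner
variable {n m p K : ℕ}

/-- The top left `n × n` corner of a `p × p` matrix. -/
def corner (n : ℕ) (V : Matrix (Fin p) (Fin p) ℂ) : Matrix (Fin n) (Fin n) ℂ :=
  (incl n p)ᴴ * V * incl n p

lemma corner_apply (h : n ≤ p) (V : Matrix (Fin p) (Fin p) ℂ) (a b : Fin n) :
    corner n V a b = V (Fin.castLE h a) (Fin.castLE h b) := by
  rw [corner, mul_incl_apply h, incl_conjTranspose_mul_apply h]

lemma hsNorm_pad_mul_mul_pad_le (h : n ≤ p) (A B : Matrix (Fin n) (Fin n) ℂ)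
    (V : Matrix (Fin p) (Fin p) ℂ) :
    hsNorm (pad p A * V * pad p B) ≤ hsNorm A * hsNorm (corner n V) * hsNorm B := by
  have e : pad p A * V * pad p B = incl n p * (A * corner n V * B) * (incl n p)ᴴ := by
    simp only [pad_eq, corner, Matrix.mul_assoc]
  rw [e, hsNorm_mul_incl_conjTranspose h, hsNorm_incl_mul h]
  exact (hsNorm_mul_le _ _).trans
    (mul_le_mul_of_nonneg_right (hsNorm_mul_le _ _) (hsNorm_nonneg _))

/-- A permutation matrix as a unitary matrix. -/
noncomputable def permUnitary (σ : Equiv.Perm (Fin p)) : Matrix.unitaryGroup (Fin p) ℂ :=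
  ⟨σ.permMatrix ℂ, by
    rw [Matrix.mem_unitaryGroup_iff, star_eq_conjTranspose, conjTranspose_permMatrix,
      ← permMatrix_mul]
    simp⟩

lemma permUnitary_mul_apply (σ : Equiv.Perm (Fin p)) (A : Matrix (Fin p) (Fin p) ℂ) (a b : Fin p) :
    ((permUnitary σ : Matrix (Fin p) (Fin p) ℂ) * A) a b = A (σ a) b := by
  simp [permUnitary, PEquiv.toMatrix_toPEquiv_mul]

/-- If left multiplication of one coordinate multiplies the unitary matrix `V` from the left, then
the rows of `V` are exchangeable and its entries have second moment `1 / p`. -/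
lemma integral_norm_sq_entry {V : (Fin m → Matrix.unitaryGroup (Fin p) ℂ) → Matrix (Fin p) (Fin p) ℂ}
    (hV : Continuous V) (hU : ∀ H, (V H)ᴴ * V H = 1) (i : Fin m)
    (heq : ∀ (u : Matrix.unitaryGroup (Fin p) ℂ) H,
      V (Pi.mulSingle i u * H) = (u : Matrix (Fin p) (Fin p) ℂ) * V H) (a b : Fin p) :
    Integrable (fun H => ‖V H a b‖ ^ 2) (Measure.pi fun _ : Fin m => haarUnitary p) ∧
      ∫ H, ‖V H a b‖ ^ 2 ∂(Measure.pi fun _ : Fin m => haarUnitary p) = 1 / p := by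
  have hsum : ∀ H, ∑ a, ‖V H a b‖ ^ 2 = 1 := by
    intro H
    have h1 := congrFun (congrFun (hU H) b) b
    rw [mul_apply, one_apply_eq] at h1
    have h2 : ((∑ a, ‖V H a b‖ ^ 2 : ℝ) : ℂ) = 1 := by
      rw [← h1]
      push_cast
      refine Finset.sum_congr rfl fun a _ => ?_
      rw [conjTranspose_apply, mul_comm]
      have := Complex.mul_conj (V H a b)
      rw [Complex.normSq_eq_norm_sq] at this
      rw [Complex.star_def, this]
      push_cast
      rfl
    exact_mod_cast h2
  have hint : ∀ a, Integrable (fun H => ‖V H a b‖ ^ 2)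
      (Measure.pi fun _ : Fin m => haarUnitary p) := by
    intro a
    refine Integrable.of_bound (C := 1)
      ((hV.matrix_elem a b).norm.pow 2).measurable.aestronglyMeasurable
      (Filter.Eventually.of_forall fun H => ?_)
    rw [Real.norm_of_nonneg (by positivity), ← hsum H]
    exact Finset.single_le_sum (f := fun a => ‖V H a b‖ ^ 2) (fun _ _ => by positivity)
      (Finset.mem_univ a)
  refine ⟨hint a, ?_⟩
  have hall : ∀ a', ∫ H, ‖V H a' b‖ ^ 2 ∂(Measure.pi fun _ : Fin m => haarUnitary p)
      = ∫ H, ‖V H a b‖ ^ 2 ∂(Measure.pi fun _ : Fin m => haarUnitary p) := by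
    intro a'
    have := integral_mul_left_eq_self (μ := Measure.pi fun _ : Fin m => haarUnitary p)
      (fun H => ‖V H a b‖ ^ 2) (Pi.mulSingle i (permUnitary (Equiv.swap a a')))
    rw [← this]
    simp only [heq, permUnitary_mul_apply, Equiv.swap_apply_left]
  have htot : ∑ a', ∫ H, ‖V H a' b‖ ^ 2 ∂(Measure.pi fun _ : Fin m => haarUnitary p) = 1 := by
    rw [← integral_finsetSum _ fun a' _ => hint a']
    simp [hsum]
  simp only [hall, Finset.sum_const, Finset.card_univ, Fintype.card_fin, nsmul_eq_mul] at htot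
  have hp : (p : ℝ) ≠ 0 := by rintro h0; simp [h0] at htot
  field_simp
  linarith

lemma integral_hsNorm_corner_le (h : n ≤ p) (hn : 0 < n)
    {V : (Fin m → Matrix.unitaryGroup (Fin p) ℂ) → Matrix (Fin p) (Fin p) ℂ}
    (hV : Continuous V) (hU : ∀ H, (V H)ᴴ * V H = 1) (i : Fin m)
    (heq : ∀ (u : Matrix.unitaryGroup (Fin p) ℂ) H,
      V (Pi.mulSingle i u * H) = (u : Matrix (Fin p) (Fin p) ℂ) * V H) :
    Integrable (fun H => hsNorm (corner n (V H))) (Measure.pi fun _ : Fin m => haarUnitary p) ∧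
      ∫ H, hsNorm (corner n (V H)) ∂(Measure.pi fun _ : Fin m => haarUnitary p)
        ≤ n ^ 2 / √p := by
  have hp : (0 : ℝ) < p := by exact_mod_cast hn.trans_le h
  have hn1 : (1 : ℝ) ≤ n := by exact_mod_cast hn
  have hsq : ∀ H, hsSq (corner n (V H))
      = ∑ a : Fin n, ∑ b : Fin n, ‖V H (Fin.castLE h a) (Fin.castLE h b)‖ ^ 2 := by
    intro H; simp only [hsSq, corner_apply h]
  have he := fun a b : Fin n =>
    integral_norm_sq_entry hV hU i heq (Fin.castLE h a) (Fin.castLE h b)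
  have hI : Integrable (fun H => hsSq (corner n (V H)))
      (Measure.pi fun _ : Fin m => haarUnitary p) := by
    simp only [hsq]
    exact integrable_finsetSum _ fun a _ => integrable_finsetSum _ fun b _ => (he a b).1
  have hI2 : ∫ H, hsSq (corner n (V H)) ∂(Measure.pi fun _ : Fin m => haarUnitary p)
      = n ^ 2 / p := by
    simp only [hsq]
    rw [integral_finsetSum _ fun a _ => integrable_finsetSum _ fun b _ => (he a b).1,
      Finset.sum_congr rfl fun a _ => integral_finsetSum _ fun b _ => (he a b).1]
    simp only [(he _ _).2, Finset.sum_const, Finset.card_univ, Fintype.card_fin, nsmul_eq_mul]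
    ring
  have hpt : ∀ H, hsNorm (corner n (V H))
      ≤ (1 / 2) * (√p * hsSq (corner n (V H)) + 1 / √p) := by
    intro H
    rw [← hsNorm_sq]
    have hs : 0 < √(p : ℝ) := Real.sqrt_pos.2 hp
    -- arithmetic and geometric means of `√p * hsNorm ^ 2` and `1 / √p`, which have the same order
    have h1 : 0 ≤ (√p * hsNorm (corner n (V H)) - 1) ^ 2 / √p := by positivity
    have h2 : (√p * hsNorm (corner n (V H)) - 1) ^ 2 / √p
        = √p * hsNorm (corner n (V H)) ^ 2 + 1 / √p - 2 * hsNorm (corner n (V H)) := by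
      field_simp; ring
    linarith
  have hJ : Integrable (fun H => (1 / 2) * (√p * hsSq (corner n (V H)) + 1 / √p))
      (Measure.pi fun _ : Fin m => haarUnitary p) :=
    ((hI.const_mul _).add (integrable_const _)).const_mul _
  have hcont : Continuous fun H => corner n (V H) :=
    Continuous.matrix_mul (Continuous.matrix_mul continuous_const hV) continuous_const
  have hint : Integrable (fun H => hsNorm (corner n (V H)))
      (Measure.pi fun _ : Fin m => haarUnitary p) :=
    hJ.mono' (continuous_hsNorm.comp hcont).measurable.aestronglyMeasurable
      (Filter.Eventually.of_forall fun H => by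
        rw [Real.norm_of_nonneg (hsNorm_nonneg _)]; exact hpt H)
  refine ⟨hint, (integral_mono hint hJ hpt).trans ?_⟩
  rw [integral_const_mul, integral_add (hI.const_mul _) (integrable_const _), integral_const_mul,
    hI2, integral_const, probReal_univ, one_smul]
  have hs : 0 < √(p : ℝ) := Real.sqrt_pos.2 hp
  have e1 : √(p : ℝ) * (n ^ 2 / p) = n ^ 2 / √p := by
    have := Real.mul_self_sqrt hp.le
    field_simp
    nlinarith
  rw [e1]
  have : 1 / √(p : ℝ) ≤ n ^ 2 / √p := by
    gcongr
    exact one_le_pow₀ hn1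
  linarith

/-- The sum of the norms of all corners that occur in off-diagonal words. -/
noncomputable def cornerSum (n : ℕ) (H : Fin m → Matrix.unitaryGroup (Fin p) ℂ) : ℝ :=
  ∑ i, hsNorm (corner n (H i : Matrix (Fin p) (Fin p) ℂ)) +
    ∑ i, ∑ j, if i ≠ j then
      hsNorm (corner n ((H i : Matrix (Fin p) (Fin p) ℂ) * (H j : Matrix (Fin p) (Fin p) ℂ)ᴴ)) else 0

lemma cornerSum_nonneg (H : Fin m → Matrix.unitaryGroup (Fin p) ℂ) : 0 ≤ cornerSum n H := by
  refine add_nonneg (Finset.sum_nonneg fun _ _ => hsNorm_nonneg _)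
    (Finset.sum_nonneg fun _ _ => Finset.sum_nonneg fun _ _ => ?_)
  split_ifs
  exacts [hsNorm_nonneg _, le_rfl]

lemma hsNorm_corner_le_cornerSum (H : Fin m → Matrix.unitaryGroup (Fin p) ℂ) (i : Fin m) :
    hsNorm (corner n (H i : Matrix (Fin p) (Fin p) ℂ)) ≤ cornerSum n H := by
  refine (Finset.single_le_sum (f := fun i => hsNorm (corner n (H i : Matrix (Fin p) (Fin p) ℂ)))
    (fun _ _ => hsNorm_nonneg _) (Finset.mem_univ i)).trans (le_add_of_nonneg_right ?_)
  refine Finset.sum_nonneg fun _ _ => Finset.sum_nonneg fun _ _ => ?_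
  split_ifs
  exacts [hsNorm_nonneg _, le_rfl]

lemma hsNorm_corner_mul_le_cornerSum (H : Fin m → Matrix.unitaryGroup (Fin p) ℂ) {i j : Fin m}
    (hij : i ≠ j) :
    hsNorm (corner n ((H i : Matrix (Fin p) (Fin p) ℂ) * (H j : Matrix (Fin p) (Fin p) ℂ)ᴴ))
      ≤ cornerSum n H := by
  have h0 : ∀ i j : Fin m, 0 ≤ if i ≠ j then hsNorm (corner n
      ((H i : Matrix (Fin p) (Fin p) ℂ) * (H j : Matrix (Fin p) (Fin p) ℂ)ᴴ)) else 0 := by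
    intro i j
    split_ifs
    exacts [hsNorm_nonneg _, le_rfl]
  have h1 := Finset.single_le_sum (f := fun i => ∑ j, if i ≠ j then hsNorm (corner n
      ((H i : Matrix (Fin p) (Fin p) ℂ) * (H j : Matrix (Fin p) (Fin p) ℂ)ᴴ)) else 0)
    (fun i _ => Finset.sum_nonneg fun j _ => h0 i j) (Finset.mem_univ i)
  have h2 := Finset.single_le_sum (f := fun j => if i ≠ j then hsNorm (corner n
      ((H i : Matrix (Fin p) (Fin p) ℂ) * (H j : Matrix (Fin p) (Fin p) ℂ)ᴴ)) else 0)
    (fun j _ => h0 i j) (Finset.mem_univ j)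
  rw [if_pos hij] at h2
  exact (h2.trans h1).trans
    (le_add_of_nonneg_left (Finset.sum_nonneg fun _ _ => hsNorm_nonneg _))

lemma integral_cornerSum_le (h : n ≤ p) (hn : 0 < n) :
    Integrable (cornerSum n) (Measure.pi fun _ : Fin m => haarUnitary p) ∧
      ∫ H, cornerSum n H ∂(Measure.pi fun _ : Fin m => haarUnitary p)
        ≤ (m + m ^ 2) * (n ^ 2 / √p) := by
  have hcoe : ∀ i : Fin m, Continuous fun H : Fin m → Matrix.unitaryGroup (Fin p) ℂ =>
      (H i : Matrix (Fin p) (Fin p) ℂ) := fun i => continuous_subtype_val.comp (continuous_apply i)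
  have hU : ∀ U : Matrix.unitaryGroup (Fin p) ℂ,
      (U : Matrix (Fin p) (Fin p) ℂ)ᴴ * (U : Matrix (Fin p) (Fin p) ℂ) = 1 := fun U =>
    Matrix.mem_unitaryGroup_iff'.1 U.2
  have h1 : ∀ i : Fin m, _ := fun i => integral_hsNorm_corner_le h hn (m := m)
    (V := fun H => (H i : Matrix (Fin p) (Fin p) ℂ)) (hcoe i) (fun H => hU _) i
    (fun u H => by simp)
  have h2 : ∀ i j : Fin m, i ≠ j → _ := fun i j hij => integral_hsNorm_corner_le h hn (m := m)
    (V := fun H => (H i : Matrix (Fin p) (Fin p) ℂ) * (H j : Matrix (Fin p) (Fin p) ℂ)ᴴ)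
    (Continuous.matrix_mul (hcoe i) (hcoe j).matrix_conjTranspose)
    (fun H => by
      rw [conjTranspose_mul, conjTranspose_conjTranspose, Matrix.mul_assoc,
        ← Matrix.mul_assoc _ _ (H j : Matrix (Fin p) (Fin p) ℂ)ᴴ, hU, Matrix.one_mul,
        unitary_mul_conjTranspose]) i
    (fun u H => by simp [Pi.mulSingle_eq_of_ne hij.symm, Matrix.mul_assoc])
  have h2' : ∀ i j : Fin m, Integrable (fun H => if i ≠ j then hsNorm (corner n
      ((H i : Matrix (Fin p) (Fin p) ℂ) * (H j : Matrix (Fin p) (Fin p) ℂ)ᴴ)) else 0)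
      (Measure.pi fun _ : Fin m => haarUnitary p) ∧
      ∫ H, (if i ≠ j then hsNorm (corner n
      ((H i : Matrix (Fin p) (Fin p) ℂ) * (H j : Matrix (Fin p) (Fin p) ℂ)ᴴ)) else 0)
      ∂(Measure.pi fun _ : Fin m => haarUnitary p) ≤ n ^ 2 / √p := by
    intro i j
    by_cases hij : i ≠ j
    · simp only [if_pos hij]
      exact h2 i j hij
    · simp only [if_neg hij, integral_zero]
      exact ⟨integrable_zero _ _ _, by positivity⟩
  have hI1 := integrable_finsetSum Finset.univ fun i _ => (h1 i).1
  have hI2 := integrable_finsetSum Finset.univ fun i _ =>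
    integrable_finsetSum Finset.univ fun j _ => (h2' i j).1
  refine ⟨hI1.add hI2, ?_⟩
  simp only [cornerSum]
  rw [integral_add hI1 hI2, integral_finsetSum _ fun i _ => (h1 i).1,
    integral_finsetSum _ fun i _ => integrable_finsetSum Finset.univ fun j _ => (h2' i j).1,
    Finset.sum_congr rfl fun i _ => integral_finsetSum _ fun j _ => (h2' i j).1]
  refine (add_le_add (Finset.sum_le_sum fun i _ => (h1 i).2)
    (Finset.sum_le_sum fun i _ => Finset.sum_le_sum fun j _ => (h2' i j).2)).trans (le_of_eq ?_)
  simp only [Finset.sum_const, Finset.card_univ, Fintype.card_fin, nsmul_eq_mul]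
  ring

/-! ### Off-diagonal words -/

/-- A monomial of degree at least two contains the corner of its first unitary factor. -/
lemma hsNorm_term_le_of_two_le (Q : NCPoly n m) (h : n ≤ p)
    (x : (Fin m → Matrix (Fin n) (Fin n) ℂ) × (Fin m → Matrix.unitaryGroup (Fin p) ℂ))
    {S : Finset (Fin m)} (hS : 2 ≤ S.card) :
    hsNorm (Q.term p x S) ≤ hsNorm (Q S) * (∏ i ∈ S, hsNorm (x.1 i)) * cornerSum n x.2 := by
  obtain ⟨i, j, l, hl⟩ : ∃ i j l, S.sort (· ≤ ·) = i :: j :: l := by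
    rcases hc : S.sort (· ≤ ·) with _ | ⟨i, _ | ⟨j, l⟩⟩
    · have := congrArg List.length hc; simp at this; simp [this] at hS
    · have := congrArg List.length hc; simp at this; omega
    · exact ⟨i, j, l, rfl⟩
  rw [← prod_map_sort S fun i => hsNorm (x.1 i), NCPoly.term, hl]
  simp only [List.map_cons, List.prod_cons]
  have e : pad p (Q S) * (rotVar p x.1 x.2 i * (rotVar p x.1 x.2 j * (l.map (rotVar p x.1 x.2)).prod))
      = (pad p (Q S * x.1 i) * (x.2 i : Matrix (Fin p) (Fin p) ℂ) * pad p (x.1 j) *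
        (x.2 j : Matrix (Fin p) (Fin p) ℂ)) * (l.map (rotVar p x.1 x.2)).prod := by
    rw [← pad_mul_pad h]
    simp only [rotVar, Matrix.mul_assoc]
  rw [e]
  have hg : 0 ≤ (l.map fun i => hsNorm (x.1 i)).prod := List.prod_nonneg fun a ha => by
    obtain ⟨b, _, rfl⟩ := List.mem_map.1 ha
    exact hsNorm_nonneg _
  calc _ ≤ hsNorm (Q S * x.1 i) * hsNorm (corner n (x.2 i : Matrix (Fin p) (Fin p) ℂ)) *
        hsNorm (x.1 j) * (l.map fun i => hsNorm (x.1 i)).prod := by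
        refine (hsNorm_mul_prod_rotVar_le h x.1 x.2 l _).trans
          (mul_le_mul_of_nonneg_right ?_ hg)
        rw [hsNorm_mul_of_mul_conjTranspose_eq_one _ (unitary_mul_conjTranspose _)]
        exact hsNorm_pad_mul_mul_pad_le h _ _ _
    _ ≤ (hsNorm (Q S) * hsNorm (x.1 i)) * cornerSum n x.2 *
        hsNorm (x.1 j) * (l.map fun i => hsNorm (x.1 i)).prod := by
        refine mul_le_mul_of_nonneg_right (mul_le_mul_of_nonneg_right (mul_le_mul
          (hsNorm_mul_le _ _) (hsNorm_corner_le_cornerSum _ _) (hsNorm_nonneg _)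
          (mul_nonneg (hsNorm_nonneg _) (hsNorm_nonneg _))) (hsNorm_nonneg _)) hg
    _ = _ := by ring

lemma NCPoly.hsNorm_term_singleton_mul_empty_le (Q : NCPoly n m) (h : n ≤ p)
    (x : (Fin m → Matrix (Fin n) (Fin n) ℂ) × (Fin m → Matrix.unitaryGroup (Fin p) ℂ)) (i : Fin m) :
    hsNorm (Q.term p x {i} * (Q.term p x ∅)ᴴ)
      ≤ hsNorm (Q {i}) * hsNorm (x.1 i) * hsNorm (Q ∅) * cornerSum n x.2 := by
  rw [Q.term_empty, Q.term_singleton h, pad_conjTranspose]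
  refine (hsNorm_pad_mul_mul_pad_le h _ _ _).trans ?_
  rw [hsNorm_conjTranspose]
  calc _ ≤ (hsNorm (Q {i}) * hsNorm (x.1 i)) * cornerSum n x.2 * hsNorm (Q ∅) :=
        mul_le_mul_of_nonneg_right (mul_le_mul (hsNorm_mul_le _ _)
          (hsNorm_corner_le_cornerSum _ _) (hsNorm_nonneg _)
          (mul_nonneg (hsNorm_nonneg _) (hsNorm_nonneg _))) (hsNorm_nonneg _)
    _ = _ := by ring

/-- A pair of monomials other than a repeated monomial of degree at most one contains a corner of a
Haar unitary, which is small. -/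
lemma NCPoly.hsNorm_term_mul_le (Q : NCPoly n m) (h : n ≤ p)
    (x : (Fin m → Matrix (Fin n) (Fin n) ℂ) × (Fin m → Matrix.unitaryGroup (Fin p) ℂ))
    {S T : Finset (Fin m)} (hST : ¬ (S = T ∧ S.card ≤ 1)) :
    hsNorm (Q.term p x S * (Q.term p x T)ᴴ)
      ≤ (hsNorm (Q S) * ∏ i ∈ S, hsNorm (x.1 i)) * (hsNorm (Q T) * ∏ i ∈ T, hsNorm (x.1 i)) *
        cornerSum n x.2 := by
  have hb : ∀ S : Finset (Fin m), 0 ≤ hsNorm (Q S) * ∏ i ∈ S, hsNorm (x.1 i) := fun S =>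
    mul_nonneg (hsNorm_nonneg _) (Finset.prod_nonneg fun _ _ => hsNorm_nonneg _)
  have hle : hsNorm (Q.term p x S * (Q.term p x T)ᴴ)
      ≤ hsNorm (Q.term p x S) * hsNorm (Q.term p x T) :=
    (hsNorm_mul_le _ _).trans (by rw [hsNorm_conjTranspose])
  have hχ := cornerSum_nonneg (n := n) x.2
  by_cases hS : 2 ≤ S.card
  · refine hle.trans ((mul_le_mul (hsNorm_term_le_of_two_le Q h x hS) (Q.hsNorm_term_le h x T)
      (hsNorm_nonneg _) (mul_nonneg (hb S) hχ)).trans (le_of_eq ?_))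
    ring
  by_cases hT : 2 ≤ T.card
  · refine hle.trans ((mul_le_mul (Q.hsNorm_term_le h x S) (hsNorm_term_le_of_two_le Q h x hT)
      (hsNorm_nonneg _) (hb S)).trans (le_of_eq ?_))
    ring
  rcases card_le_one_cases (show S.card ≤ 1 by omega) with rfl | ⟨i, rfl⟩ <;>
  rcases card_le_one_cases (show T.card ≤ 1 by omega) with rfl | ⟨j, rfl⟩
  · simp at hST
  · rw [← hsNorm_conjTranspose, conjTranspose_mul, conjTranspose_conjTranspose]
    refine (Q.hsNorm_term_singleton_mul_empty_le h x j).trans (le_of_eq ?_)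
    simp only [Finset.prod_singleton, Finset.prod_empty]
    ring
  · refine (Q.hsNorm_term_singleton_mul_empty_le h x i).trans (le_of_eq ?_)
    simp only [Finset.prod_singleton, Finset.prod_empty]
    ring
  · have hij : i ≠ j := by rintro rfl; simp at hST
    have e : Q.term p x {i} * (Q.term p x {j})ᴴ = pad p (Q {i} * x.1 i) *
        ((x.2 i : Matrix (Fin p) (Fin p) ℂ) * (x.2 j : Matrix (Fin p) (Fin p) ℂ)ᴴ) *
        pad p (Q {j} * x.1 j)ᴴ := by
      rw [Q.term_singleton h, Q.term_singleton h, conjTranspose_mul, pad_conjTranspose]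
      simp only [Matrix.mul_assoc]
    rw [e]
    refine (hsNorm_pad_mul_mul_pad_le h _ _ _).trans ?_
    rw [hsNorm_conjTranspose]
    simp only [Finset.prod_singleton]
    calc _ ≤ (hsNorm (Q {i}) * hsNorm (x.1 i)) * cornerSum n x.2 *
          (hsNorm (Q {j}) * hsNorm (x.1 j)) :=
          mul_le_mul (mul_le_mul (hsNorm_mul_le _ _) (hsNorm_corner_mul_le_cornerSum _ hij)
            (hsNorm_nonneg _) (mul_nonneg (hsNorm_nonneg _) (hsNorm_nonneg _)))
            (hsNorm_mul_le _ _) (hsNorm_nonneg _)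
            (mul_nonneg (mul_nonneg (hsNorm_nonneg _) (hsNorm_nonneg _)) hχ)
      _ = _ := by ring

variable {ν : Measure (Matrix (Fin n) (Fin n) ℂ)} [IsProbabilityMeasure ν]

/-- Without repeated indices, a word that is not diagonal with letters of degree at most one is of
order `p ^ (-1 / 2)`. Only second moments of the `G i` enter, so the bound does not involve `c`. -/
lemma NCPoly.norm_integral_wordTrace_le (Q : NCPoly n m) (h : n ≤ p) (hn : 0 < n) (hK : 1 ≤ K)
    (hν : IsNormalizedEnsemble ν) (hQ : ∀ S, hsSq (Q S) ≤ n)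
    {s t : Fin K → Finset (Fin m)} (hs : ∀ i, mult s i ≤ 1) (ht : ∀ i, mult t i ≤ 1)
    (hst : ¬ (s = t ∧ ∀ j, (s j).card ≤ 1)) :
    ‖∫ x, Q.wordTrace p x s t ∂(inputLaw m p ν)‖
      ≤ n * n ^ K * (1 + n) ^ m * ((m + m ^ 2) * (n ^ 2 / √p)) := by
  obtain ⟨j0, hj0⟩ : ∃ j, ¬ (s j = t j ∧ (s j).card ≤ 1) := by
    by_contra hcon
    push Not at hcon
    exact hst ⟨funext fun j => (hcon j).1, fun j => (hcon j).2⟩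
  have hQ' : ∀ S, hsNorm (Q S) ≤ √n := fun S => Real.sqrt_le_sqrt (hQ S)
  have hpt : ∀ x : (Fin m → Matrix (Fin n) (Fin n) ℂ) × (Fin m → Matrix.unitaryGroup (Fin p) ℂ),
      ‖Q.wordTrace p x s t‖ ≤ n * n ^ K * ((∏ i, (1 + hsSq (x.1 i))) * cornerSum n x.2) := by
    intro x
    have hχ := cornerSum_nonneg (n := n) x.2
    set b : Finset (Fin m) → ℝ := fun S => hsNorm (Q S) * ∏ i ∈ S, hsNorm (x.1 i) with hb
    have hb0 : ∀ S : Finset (Fin m), 0 ≤ b S := fun S =>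
      mul_nonneg (hsNorm_nonneg _) (Finset.prod_nonneg fun _ _ => hsNorm_nonneg _)
    have h1 : ∏ j, hsNorm (Q.term p x (s j) * (Q.term p x (t j))ᴴ)
        ≤ (∏ j, b (s j) * b (t j)) * cornerSum n x.2 := by
      rw [← Finset.mul_prod_erase _ _ (Finset.mem_univ j0),
        ← Finset.mul_prod_erase _ (fun j => b (s j) * b (t j)) (Finset.mem_univ j0)]
      calc _ ≤ (b (s j0) * b (t j0) * cornerSum n x.2) *
            ∏ j ∈ Finset.univ.erase j0, b (s j) * b (t j) := by
            refine mul_le_mul (Q.hsNorm_term_mul_le h x hj0)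
              (Finset.prod_le_prod (fun _ _ => hsNorm_nonneg _) fun j _ => ?_)
              (Finset.prod_nonneg fun _ _ => hsNorm_nonneg _)
              (mul_nonneg (mul_nonneg (hb0 _) (hb0 _)) hχ)
            refine (hsNorm_mul_le _ _).trans ?_
            rw [hsNorm_conjTranspose]
            exact mul_le_mul (Q.hsNorm_term_le h x _) (Q.hsNorm_term_le h x _) (hsNorm_nonneg _)
              (hb0 _)
        _ = _ := by ring
    have h2 : ∏ j, b (s j) * b (t j) ≤ n ^ K * ∏ i, (1 + hsSq (x.1 i)) := by
      have e : ∏ j, b (s j) * b (t j) = (∏ j, hsNorm (Q (s j)) * hsNorm (Q (t j))) *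
          ∏ i, hsNorm (x.1 i) ^ (mult s i + mult t i) := by
        simp only [hb, pow_add, Finset.prod_mul_distrib, prod_prod_eq_prod_pow_mult]
        ring
      rw [e]
      refine mul_le_mul ?_ ?_ (Finset.prod_nonneg fun _ _ => pow_nonneg (hsNorm_nonneg _) _)
        (by positivity)
      · calc _ ≤ ∏ _j : Fin K, (n : ℝ) := by
              refine Finset.prod_le_prod
                (fun _ _ => mul_nonneg (hsNorm_nonneg _) (hsNorm_nonneg _)) fun j _ => ?_
              rw [← Real.mul_self_sqrt (Nat.cast_nonneg n)]
              exact mul_le_mul (hQ' _) (hQ' _) (hsNorm_nonneg _) (Real.sqrt_nonneg _)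
          _ = _ := by simp
      · refine Finset.prod_le_prod (fun _ _ => pow_nonneg (hsNorm_nonneg _) _) fun i _ => ?_
        rw [← hsNorm_sq]
        have := hs i
        have := ht i
        exact pow_le_one_add_pow (hsNorm_nonneg _) (by omega)
    calc _ ≤ n * ((n ^ K * ∏ i, (1 + hsSq (x.1 i))) * cornerSum n x.2) :=
          (Q.norm_wordTrace_le h hK x s t).trans (mul_le_mul_of_nonneg_left
            (h1.trans (mul_le_mul_of_nonneg_right h2 hχ)) (Nat.cast_nonneg n))
      _ = _ := by ring
  obtain ⟨hχi, hχ⟩ := integral_cornerSum_le (m := m) h hn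
  have hG : Integrable (fun G : Fin m → Matrix (Fin n) (Fin n) ℂ => ∏ i, (1 + hsSq (G i)))
      (Measure.pi fun _ : Fin m => ν) :=
    Integrable.fintype_prod (f := fun _ G => 1 + hsSq G)
      fun _ => (integrable_const _).add hν.integral_hsSq.1
  have hGe : ∫ G : Fin m → Matrix (Fin n) (Fin n) ℂ, ∏ i, (1 + hsSq (G i))
      ∂(Measure.pi fun _ : Fin m => ν) = (1 + n) ^ m := by
    have := integral_fintype_prod_eq_pow (ι := Fin m) (μ := ν)
      (fun G : Matrix (Fin n) (Fin n) ℂ => 1 + hsSq G)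
    rw [this, integral_add (integrable_const _) hν.integral_hsSq.1, hν.integral_hsSq.2,
      integral_const, probReal_univ, one_smul, Fintype.card_fin]
  calc _ ≤ ∫ x, n * n ^ K * ((∏ i, (1 + hsSq (x.1 i))) * cornerSum n x.2) ∂(inputLaw m p ν) :=
        norm_integral_le_of_norm_le ((hG.mul_prod hχi).const_mul _)
          (Filter.Eventually.of_forall hpt)
    _ = n * n ^ K * ((1 + n) ^ m *
        ∫ H, cornerSum n H ∂(Measure.pi fun _ : Fin m => haarUnitary p)) := by
        rw [integral_const_mul, inputLaw, integral_prod_mul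
          (fun G : Fin m → Matrix (Fin n) (Fin n) ℂ => ∏ i, (1 + hsSq (G i))), hGe]
    _ ≤ n * n ^ K * ((1 + n) ^ m * ((m + m ^ 2) * (n ^ 2 / √p))) := by gcongr
    _ = _ := by ring

end Corner

/-! ### The Boolean moment -/

section Boolean
variable {n m K : ℕ}

/-- The Walsh function of index `S`. -/
noncomputable def walsh (S : Finset (Fin m)) (σ : Fin m → ℤˣ) : ℂ := ∏ i ∈ S, (((σ i : ℤˣ) : ℤ) : ℂ)

lemma NCPoly.evalSign_eq (Q : NCPoly n m) (σ : Fin m → ℤˣ) :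
    Q.evalSign σ = ∑ S, walsh S σ • Q S := by
  rw [NCPoly.evalSign, NCPoly.eval]
  refine Finset.sum_congr rfl fun S _ => ?_
  rw [prod_map_smul (fun i => (((σ i : ℤˣ) : ℤ) : ℂ)) (fun _ => 1), prod_map_sort]
  simp [walsh]

lemma sum_walsh_mul (S T : Finset (Fin m)) :
    ∑ σ : Fin m → ℤˣ, walsh S σ * walsh T σ = if S = T then 2 ^ m else 0 := by
  have e : ∀ σ : Fin m → ℤˣ, walsh S σ * walsh T σ
      = ∏ i, ((if i ∈ S then (((σ i : ℤˣ) : ℤ) : ℂ) else 1) *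
        (if i ∈ T then (((σ i : ℤˣ) : ℤ) : ℂ) else 1)) := by
    intro σ
    rw [Finset.prod_mul_distrib, Finset.prod_ite_mem, Finset.prod_ite_mem, Finset.univ_inter,
      Finset.univ_inter, walsh, walsh]
  have h2 := Finset.prod_univ_sum (fun _ : Fin m => (Finset.univ : Finset ℤˣ))
    (fun i u => (if i ∈ S then (((u : ℤˣ) : ℤ) : ℂ) else 1) *
        (if i ∈ T then (((u : ℤˣ) : ℤ) : ℂ) else 1))
  rw [Fintype.piFinset_univ] at h2
  simp only [e]
  rw [← h2]
  by_cases h : S = T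
  · subst h
    rw [if_pos rfl, Finset.prod_congr rfl (g := fun _ => (2 : ℂ))]
    · simp
    · intro i _
      by_cases hi : i ∈ S <;> simp [hi]
      all_goals norm_num
  · rw [if_neg h]
    have : ∃ i, ¬ (i ∈ S ↔ i ∈ T) := by
      by_contra hcon
      push Not at hcon
      exact h (Finset.ext hcon)
    obtain ⟨i, hi⟩ := this
    refine Finset.prod_eq_zero (Finset.mem_univ i) ?_
    by_cases hS : i ∈ S <;> by_cases hT : i ∈ T <;> simp_all

lemma star_walsh (S : Finset (Fin m)) (σ : Fin m → ℤˣ) : star (walsh S σ) = walsh S σ := by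
  simp [walsh]

/-- Parseval's identity for matrix valued functions on the cube. -/
lemma NCPoly.sum_evalSign_mul (Q : NCPoly n m) :
    ∑ σ : Fin m → ℤˣ, Q.evalSign σ * (Q.evalSign σ)ᴴ = (2 : ℂ) ^ m • ∑ S, Q S * (Q S)ᴴ := by
  simp only [Q.evalSign_eq, conjTranspose_sum, conjTranspose_smul, star_walsh, Finset.sum_mul_sum,
    smul_mul_smul_comm]
  rw [Finset.sum_comm, Finset.smul_sum]
  refine Finset.sum_congr rfl fun S _ => ?_
  rw [Finset.sum_comm]
  simp only [← Finset.sum_smul, sum_walsh_mul]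
  simp

lemma NCPoly.sum_hsSq_le (Q : NCPoly n m) (hQ : ∀ σ : Fin m → ℤˣ, opNorm (Q.evalSign σ) ≤ 1) :
    ∑ S, hsSq (Q S) ≤ n := by
  have h1 : ∀ σ, hsSq (Q.evalSign σ) ≤ n := by
    intro σ
    have h2 := hsSq_mul_le (Q.evalSign σ) (1 : Matrix (Fin n) (Fin n) ℂ)
    rw [Matrix.mul_one, ← hsNorm_sq 1, hsNorm_one, Real.sq_sqrt (Nat.cast_nonneg _),
      Fintype.card_fin] at h2
    refine h2.trans (mul_le_of_le_one_left (Nat.cast_nonneg n) ?_)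
    exact pow_le_one₀ (norm_nonneg _) (hQ σ)
  have h2 := congrArg trace Q.sum_evalSign_mul
  rw [trace_sum, trace_smul, trace_sum] at h2
  simp only [trace_mul_conjTranspose, smul_eq_mul] at h2
  have h3 : ∑ σ : Fin m → ℤˣ, hsSq (Q.evalSign σ) = 2 ^ m * ∑ S, hsSq (Q S) := by
    exact_mod_cast h2
  have h4 : ∑ σ : Fin m → ℤˣ, hsSq (Q.evalSign σ) ≤ 2 ^ m * n := by
    refine (Finset.sum_le_sum fun σ _ => h1 σ).trans (le_of_eq ?_)
    simp [Finset.card_univ]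
  rw [h3] at h4
  exact le_of_mul_le_mul_left h4 (by positivity)

/-- Jensen's inequality: dropping all coefficients outside `F` and averaging `Q Qᴴ` before taking
the power decreases the Boolean moment. -/
lemma NCPoly.re_trace_pow_le_signMoment (Q : NCPoly n m) (hn : 0 < n) (hK : 1 ≤ K)
    (F : Finset (Finset (Fin m))) :
    (trace ((∑ S ∈ F, Q S * (Q S)ᴴ) ^ K)).re ≤ n * Q.signMoment K := by
  obtain ⟨k, rfl⟩ : ∃ k, K = k + 1 := ⟨K - 1, by omega⟩
  set N := ∑ S ∈ F, Q S * (Q S)ᴴ with hN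
  have hNp : N.PosSemidef := posSemidef_sum _ fun S _ => posSemidef_self_mul_conjTranspose (Q S)
  have hterm : ∀ S, 0 ≤ (trace (N ^ k * (Q S * (Q S)ᴴ))).re := by
    intro S
    rw [← Matrix.mul_assoc, trace_mul_comm, ← Matrix.mul_assoc]
    have := ((hNp.pow k).conjTranspose_mul_mul_same (Q S)).trace_nonneg
    exact (Complex.le_def.1 this).1
  have h1 : (trace (N ^ (k + 1))).re ≤ (trace (N ^ k * ∑ S, Q S * (Q S)ᴴ)).re := by
    have e : N ^ (k + 1) = N ^ k * ∑ S ∈ F, Q S * (Q S)ᴴ := pow_succ N k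
    rw [e]
    simp only [Finset.mul_sum, trace_sum, Complex.re_sum]
    exact Finset.sum_le_sum_of_subset_of_nonneg (Finset.subset_univ F) fun S _ _ => hterm S
  have h2 : ∀ σ : Fin m → ℤˣ, _ := fun σ =>
    young_trace hNp (posSemidef_self_mul_conjTranspose (Q.evalSign σ)) k
  have h3 := Finset.sum_le_sum fun (σ : Fin m → ℤˣ) (_ : σ ∈ Finset.univ) => h2 σ
  rw [← Finset.mul_sum, ← Complex.re_sum, ← trace_sum, ← Finset.mul_sum, Q.sum_evalSign_mul,
    Finset.sum_add_distrib] at h3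
  have hcard : ((Finset.univ : Finset (Fin m → ℤˣ)).card : ℝ) = 2 ^ m := by
    simp [Finset.card_univ]
  rw [Finset.sum_const, nsmul_eq_mul, hcard, Matrix.mul_smul, trace_smul, smul_eq_mul] at h3
  have h4 : ((2 : ℂ) ^ m * trace (N ^ k * ∑ S, Q S * (Q S)ᴴ)).re
      = 2 ^ m * (trace (N ^ k * ∑ S, Q S * (Q S)ᴴ)).re := by
    have : (2 : ℂ) ^ m = ((2 ^ m : ℝ) : ℂ) := by push_cast; rfl
    rw [this, Complex.re_ofReal_mul]
  rw [h4] at h3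
  have h5 : n * Q.signMoment (k + 1) = ((2 : ℝ) ^ m)⁻¹ *
      ∑ σ : Fin m → ℤˣ, (trace ((Q.evalSign σ * (Q.evalSign σ)ᴴ) ^ (k + 1))).re := by
    rw [NCPoly.signMoment, ← Finset.mul_sum]
    simp only [matAbs_pow_two_mul]
    have : (n : ℝ) ≠ 0 := by positivity
    field_simp
  rw [h5, inv_mul_eq_div, le_div_iff₀ (by positivity)]
  have h6 := mul_le_mul_of_nonneg_left h1 (show (0 : ℝ) ≤ (k + 1) * 2 ^ m by positivity)
  nlinarith

/-- The real part of the trace of the diagonal word, the product of the `Q (s j) (Q (s j))ᴴ`. -/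
noncomputable def NCPoly.diagTrace (Q : NCPoly n m) (s : Fin K → Finset (Fin m)) : ℝ :=
  (trace (List.ofFn fun j => Q (s j) * (Q (s j))ᴴ).prod).re

lemma NCPoly.re_trace_sum_pow (Q : NCPoly n m) (F : Finset (Finset (Fin m))) :
    (trace ((∑ S ∈ F, Q S * (Q S)ᴴ) ^ K)).re
      = ∑ s : Fin K → Finset (Fin m), if ∀ j, s j ∈ F then Q.diagTrace s else 0 := by
  have e : ∑ S ∈ F, Q S * (Q S)ᴴ = ∑ S, (if S ∈ F then (1 : ℂ) else 0) • (Q S * (Q S)ᴴ) := by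
    simp [ite_smul]
  rw [e, sum_pow_eq_sum_ofFn, trace_sum, Complex.re_sum]
  refine Finset.sum_congr rfl fun s _ => ?_
  rw [prod_ofFn_smul, Finset.prod_boole, trace_smul]
  by_cases h : ∀ j, s j ∈ F <;> simp [h, NCPoly.diagTrace]

lemma NCPoly.abs_diagTrace_le (Q : NCPoly n m) (s : Fin K → Finset (Fin m)) :
    |Q.diagTrace s| ≤ n * ∏ j, hsSq (Q (s j)) := by
  refine (Complex.abs_re_le_norm _).trans ((norm_trace_le _).trans ?_)
  have h := hsNorm_mul_prod_ofFn_le (1 : Matrix (Fin n) (Fin n) ℂ)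
    fun j => Q (s j) * (Q (s j))ᴴ
  rw [Matrix.one_mul, hsNorm_one, Fintype.card_fin] at h
  rw [Fintype.card_fin, ← Real.mul_self_sqrt (Nat.cast_nonneg n), mul_assoc,
    Real.sqrt_mul_self (Real.sqrt_nonneg _)]
  refine mul_le_mul_of_nonneg_left (h.trans (mul_le_mul_of_nonneg_left ?_ (Real.sqrt_nonneg _)))
    (Real.sqrt_nonneg _)
  refine Finset.prod_le_prod (fun _ _ => hsNorm_nonneg _) fun j _ => ?_
  refine (hsNorm_mul_le _ _).trans (le_of_eq ?_)
  rw [hsNorm_conjTranspose, ← hsNorm_sq, sq]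

end Boolean

/-! ### Influences -/

section Influence
variable {n m K d : ℕ}

lemma NCPoly.influence_eq (Q : NCPoly n m) (i : Fin m) :
    Q.influence i = ∑ S, if i ∈ S then hsSq (Q S) else 0 := by
  rw [NCPoly.influence, Finset.sum_filter]
  refine Finset.sum_congr rfl fun S _ => ?_
  rw [trace_mul_conjTranspose, Complex.ofReal_re]

lemma NCPoly.influence_nonneg (Q : NCPoly n m) (i : Fin m) : 0 ≤ Q.influence i := by
  rw [Q.influence_eq]
  refine Finset.sum_nonneg fun S _ => ?_
  split_ifs
  exacts [hsSq_nonneg _, le_rfl]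

lemma NCPoly.influence_le_maxInfluence (Q : NCPoly n m) (i : Fin m) :
    Q.influence i ≤ Q.maxInfluence := le_ciSup (Set.finite_range _).bddAbove i

lemma NCPoly.maxInfluence_nonneg (Q : NCPoly n m) : 0 ≤ Q.maxInfluence :=
  Real.iSup_nonneg Q.influence_nonneg

lemma NCPoly.maxInfluence_le (Q : NCPoly n m) : Q.maxInfluence ≤ ∑ S, hsSq (Q S) := by
  refine Real.iSup_le (fun i => ?_) (Finset.sum_nonneg fun _ _ => hsSq_nonneg _)
  rw [Q.influence_eq]
  refine Finset.sum_le_sum fun S _ => ?_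
  split_ifs
  exacts [le_rfl, hsSq_nonneg _]

lemma NCPoly.sum_influence_le (Q : NCPoly n m) (hd : ∀ S, Q S ≠ 0 → S.card ≤ d) :
    ∑ i, Q.influence i ≤ d * ∑ S, hsSq (Q S) := by
  simp only [Q.influence_eq]
  rw [Finset.sum_comm, Finset.mul_sum]
  refine Finset.sum_le_sum fun S _ => ?_
  rw [Finset.sum_ite_mem, Finset.univ_inter, Finset.sum_const, nsmul_eq_mul]
  by_cases h : Q S = 0
  · simp [h, hsSq]
  · exact mul_le_mul_of_nonneg_right (by exact_mod_cast hd S h) (hsSq_nonneg _)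

lemma NCPoly.sum_nonempty_hsSq_le (Q : NCPoly n m) :
    (∑ S, if S ≠ ∅ then hsSq (Q S) else 0) ≤ m * Q.maxInfluence := by
  calc _ ≤ ∑ i, Q.influence i := by
        simp only [Q.influence_eq]
        rw [Finset.sum_comm]
        refine Finset.sum_le_sum fun S _ => ?_
        rw [Finset.sum_ite_mem, Finset.univ_inter, Finset.sum_const, nsmul_eq_mul]
        split_ifs with h
        · refine le_mul_of_one_le_left (hsSq_nonneg _) ?_
          exact_mod_cast Finset.card_pos.2 (Finset.nonempty_iff_ne_empty.2 h)
        · exact mul_nonneg (Nat.cast_nonneg _) (hsSq_nonneg _)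
    _ ≤ ∑ _i : Fin m, Q.maxInfluence := Finset.sum_le_sum fun i _ => Q.influence_le_maxInfluence i
    _ = _ := by simp

lemma NCPoly.sum_repeated_le (Q : NCPoly n m) (hK : 1 ≤ K) (hd : ∀ S, Q S ≠ 0 → S.card ≤ d)
    (hW : ∑ S, hsSq (Q S) ≤ n) :
    ∑ s : Fin K → Finset (Fin m), (if ∃ i, 2 ≤ mult s i then ∏ j, hsSq (Q (s j)) else 0)
      ≤ K * (K - 1) * (d * Q.maxInfluence * n ^ (K - 1)) := by
  have h1 := sum_two_le_mult_le (K := K) (v := fun S => hsSq (Q S)) fun S => hsSq_nonneg _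
  have hK1 : (1 : ℝ) ≤ K := by exact_mod_cast hK
  have hW0 : 0 ≤ ∑ S, hsSq (Q S) := Finset.sum_nonneg fun _ _ => hsSq_nonneg _
  have hτ := Q.maxInfluence_nonneg
  rcases hK.eq_or_lt with rfl | hK2
  · simpa using h1
  refine h1.trans (mul_le_mul_of_nonneg_left ?_
    (mul_nonneg (by positivity) (by linarith)))
  simp only [← Q.influence_eq]
  have h2 : ∑ i, Q.influence i ^ 2 ≤ Q.maxInfluence * (d * ∑ S, hsSq (Q S)) := by
    refine le_trans ?_ (mul_le_mul_of_nonneg_left (Q.sum_influence_le hd) hτ)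
    rw [Finset.mul_sum]
    refine Finset.sum_le_sum fun i _ => ?_
    rw [sq]
    exact mul_le_mul_of_nonneg_right (Q.influence_le_maxInfluence i) (Q.influence_nonneg i)
  calc _ ≤ (Q.maxInfluence * (d * ∑ S, hsSq (Q S))) * (∑ S, hsSq (Q S)) ^ (K - 2) :=
        mul_le_mul_of_nonneg_right h2 (pow_nonneg hW0 _)
    _ = d * Q.maxInfluence * (∑ S, hsSq (Q S)) ^ (K - 1) := by
        obtain ⟨k, rfl⟩ : ∃ k, K = k + 2 := ⟨K - 2, by omega⟩
        simp only [Nat.add_sub_cancel, show k + 2 - 1 = k + 1 by omega, pow_succ]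
        ring
    _ ≤ _ := by gcongr

lemma NCPoly.sum_nontrivial_le (Q : NCPoly n m) (hW : ∑ S, hsSq (Q S) ≤ n) :
    ∑ s : Fin K → Finset (Fin m), (if mult s ≠ 0 then ∏ j, hsSq (Q (s j)) else 0)
      ≤ K * (m * Q.maxInfluence * n ^ (K - 1)) := by
  have h1 := sum_mult_ne_zero_le (K := K) (v := fun S => hsSq (Q S)) fun S => hsSq_nonneg _
  have hW0 : 0 ≤ ∑ S, hsSq (Q S) := Finset.sum_nonneg fun _ _ => hsSq_nonneg _
  have hτ := Q.maxInfluence_nonneg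
  refine h1.trans (mul_le_mul_of_nonneg_left ?_ (Nat.cast_nonneg _))
  exact mul_le_mul Q.sum_nonempty_hsSq_le (pow_le_pow_left₀ hW0 hW _) (pow_nonneg hW0 _)
    (by positivity)

end Influence

/-! ### Comparison of the moments -/

section Comparison
variable {n m p K d : ℕ} {ν : Measure (Matrix (Fin n) (Fin n) ℂ)} [IsProbabilityMeasure ν] {c : ℝ}

lemma NCPoly.integral_rotatedTrace (Q : NCPoly n m) (h : n ≤ p) (hK : 1 ≤ K)
    (hi : MatIntegrable ν fun G => (G * Gᴴ) ^ K) :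
    Integrable (Q.rotatedTrace p K) (inputLaw m p ν) ∧
      ∫ x, Q.rotatedTrace p K x ∂(inputLaw m p ν) = (1 / (n : ℝ)) *
        ∑ s : Fin K → Finset (Fin m), ∑ t : Fin K → Finset (Fin m),
          (∫ x, Q.wordTrace p x s t ∂(inputLaw m p ν)).re := by
  have hword := fun s t : Fin K → Finset (Fin m) => Q.integrable_wordTrace (p := p) h hK hi s t
  have hre : ∀ s t : Fin K → Finset (Fin m), Integrable (fun x => (Q.wordTrace p x s t).re)
      (inputLaw m p ν) := fun s t => (hword s t).re
  have e : Q.rotatedTrace p K = fun x => (1 / (n : ℝ)) *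
      ∑ s : Fin K → Finset (Fin m), ∑ t : Fin K → Finset (Fin m), (Q.wordTrace p x s t).re :=
    funext fun x => Q.rotatedTrace_eq p K x
  rw [e]
  refine ⟨(integrable_finsetSum _ fun s _ =>
    integrable_finsetSum _ fun t _ => hre s t).const_mul _, ?_⟩
  rw [integral_const_mul, integral_finsetSum _ fun s _ => integrable_finsetSum _ fun t _ => hre s t]
  congr 1
  refine Finset.sum_congr rfl fun s _ => ?_
  rw [integral_finsetSum _ fun t _ => hre s t]
  exact Finset.sum_congr rfl fun t _ => integral_re (hword s t)

/-- The comparison of moments, given a class `P` of multiplicities outside of which every word is,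
up to an error `E`, a diagonal word with letters in `F`. -/
lemma NCPoly.integral_rotatedTrace_le (Q : NCPoly n m) (h : n ≤ p) (hn : 0 < n) (hK : 1 ≤ K)
    (hc1 : 1 ≤ c) (hi : MatIntegrable ν fun G => (G * Gᴴ) ^ K)
    (hc : opNorm (matExpect ν fun G => (G * Gᴴ) ^ K) ≤ c)
    (hd : ∀ S, Q S ≠ 0 → S.card ≤ d) (P : (Fin m → ℕ) → Prop) [DecidablePred P]
    (F : Finset (Finset (Fin m))) {E : ℝ} (hE : 0 ≤ E)
    (hP : ∀ s t : Fin K → Finset (Fin m), ¬ P (mult s) → mult s = mult t →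
      (∫ x, Q.wordTrace p x s t ∂(inputLaw m p ν)).re
        ≤ (if s = t ∧ ∀ j, s j ∈ F then Q.diagTrace s else 0) + E) :
    ∫ x, Q.rotatedTrace p K x ∂(inputLaw m p ν) ≤ Q.signMoment K
      + ((K : ℝ) ^ (d * K) * c ^ d + 1) *
        (∑ s : Fin K → Finset (Fin m), if P (mult s) then ∏ j, hsSq (Q (s j)) else 0)
      + ((2 : ℝ) ^ m) ^ (2 * K) * E / n := by
  have hn' : (0 : ℝ) < n := by exact_mod_cast hn
  set R := ∑ s : Fin K → Finset (Fin m), if P (mult s) then ∏ j, hsSq (Q (s j)) else 0 with hR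
  set a : (Fin K → Finset (Fin m)) → (Fin K → Finset (Fin m)) → ℝ := fun s t =>
    (∫ x, Q.wordTrace p x s t ∂(inputLaw m p ν)).re with ha
  have h1 : ∀ s t, a s t ≤ (if P (mult s) ∧ mult s = mult t then a s t else 0)
      + (if s = t then (if ¬ P (mult s) ∧ ∀ j, s j ∈ F then Q.diagTrace s else 0) else 0) + E := by
    intro s t
    by_cases hst : mult s = mult t
    · by_cases hPs : P (mult s)
      · simp [hPs, hst.symm, hE]
      · refine (hP s t hPs hst).trans (le_of_eq ?_)
        simp only [hPs, false_and, if_false, not_false_eq_true, true_and, zero_add]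
        congr 1
        by_cases e : s = t <;> simp [e]
    · have e : s ≠ t := fun e => hst (congrArg mult e)
      have h0 : a s t = 0 := by
        simp only [ha]
        rw [Q.integral_wordTrace_eq_zero h hK hi hst, Complex.zero_re]
      simp [h0, e, hE]
  have h2 : ∑ s, ∑ t, a s t ≤ n * ((K : ℝ) ^ (d * K) * (c ^ d * R))
      + ∑ s : Fin K → Finset (Fin m), (if ¬ P (mult s) ∧ ∀ j, s j ∈ F then Q.diagTrace s else 0)
      + ((2 : ℝ) ^ m) ^ (2 * K) * E := by
    refine (Finset.sum_le_sum fun s _ => Finset.sum_le_sum fun t _ => h1 s t).trans ?_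
    simp only [Finset.sum_add_distrib]
    refine add_le_add (add_le_add ?_ (le_of_eq ?_)) (le_of_eq ?_)
    · exact Q.sum_wordTrace_le h hK hc1 hi hc hd P
    · refine Finset.sum_congr rfl fun s _ => ?_
      rw [Finset.sum_ite_eq]
      simp
    · simp only [Finset.sum_const, nsmul_eq_mul, Finset.card_univ, Fintype.card_fun,
        Fintype.card_finset, Fintype.card_fin]
      push_cast
      ring
  have h3 : ∑ s : Fin K → Finset (Fin m),
      (if ¬ P (mult s) ∧ ∀ j, s j ∈ F then Q.diagTrace s else 0)
      ≤ n * Q.signMoment K + n * R := by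
    -- the full sum of diagonal words is a trace to which Jensen's inequality applies; the surplus
    -- words satisfy `P`
    have h4 := Q.re_trace_pow_le_signMoment hn hK F
    rw [Q.re_trace_sum_pow] at h4
    refine le_trans ?_ (add_le_add_left h4 _)
    rw [hR, Finset.mul_sum, ← Finset.sum_add_distrib]
    refine Finset.sum_le_sum fun s _ => ?_
    have h5 := neg_abs_le (Q.diagTrace s)
    have h6 := Q.abs_diagTrace_le s
    have h7 : (0 : ℝ) ≤ n * ∏ j, hsSq (Q (s j)) := (abs_nonneg _).trans h6
    by_cases hPs : P (mult s) <;> by_cases hF : ∀ j, s j ∈ F <;> simp only [hPs, hF, if_true,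
      if_false, not_true_eq_false, not_false_eq_true, and_true, and_false, implies_true] <;>
      linarith
  rw [(Q.integral_rotatedTrace h hK hi).2]
  have h8 := h2.trans (add_le_add_left (add_le_add_right h3 _) _)
  rw [one_div, inv_mul_le_iff₀ hn']
  refine h8.trans (le_of_eq ?_)
  field_simp
  ring

lemma mult_eq_zero_iff (s : Fin K → Finset (Fin m)) : mult s = 0 ↔ s = fun _ => ∅ := by
  constructor
  · intro h
    funext j
    refine Finset.eq_empty_of_forall_notMem fun i hij => ?_
    have := congrFun h i
    rw [Pi.zero_apply, mult, Finset.card_eq_zero, Finset.filter_eq_empty_iff] at this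
    exact this (Finset.mem_univ j) hij
  · rintro rfl
    funext i
    simp [mult]

/-- Comparison in which every word other than the trivial one counts as error. -/
lemma NCPoly.integral_rotatedTrace_le_of_influence (Q : NCPoly n m) (h : n ≤ p) (hn : 0 < n)
    (hK : 1 ≤ K) (hν : IsNormalizedEnsemble ν)
    (hc1 : 1 ≤ c) (hi : MatIntegrable ν fun G => (G * Gᴴ) ^ K)
    (hc : opNorm (matExpect ν fun G => (G * Gᴴ) ^ K) ≤ c)
    (hd : ∀ S, Q S ≠ 0 → S.card ≤ d) (hW : ∑ S, hsSq (Q S) ≤ n) :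
    ∫ x, Q.rotatedTrace p K x ∂(inputLaw m p ν) ≤ Q.signMoment K
      + ((K : ℝ) ^ (d * K) * c ^ d + 1) * (K * (m * Q.maxInfluence * n ^ (K - 1))) := by
  have h1 := Q.integral_rotatedTrace_le h hn hK hc1 hi hc hd (fun κ => κ ≠ 0) {∅} le_rfl (by
    intro s t hs hst
    push Not at hs
    have hs' := (mult_eq_zero_iff s).1 hs
    have ht' := (mult_eq_zero_iff t).1 (hst ▸ hs)
    have e : s = t := hs'.trans ht'.symm
    subst e
    rw [Q.integral_wordTrace_diagonal h hK hν (fun j => by simp [hs']) (fun i => by simp [hs]),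
      if_pos ⟨rfl, fun j => by simp [hs']⟩, add_zero]
    exact le_rfl)
  rw [mul_zero, zero_div, add_zero] at h1
  refine h1.trans (add_le_add_right (mul_le_mul_of_nonneg_left (Q.sum_nontrivial_le hW) ?_) _)
  have : 0 ≤ c := zero_le_one.trans hc1
  positivity

/-- Comparison in which the words with a repeated index are bounded through the influences, and the
other words through their corners. -/
lemma NCPoly.integral_rotatedTrace_le_of_corner (Q : NCPoly n m) (h : n ≤ p) (hn : 0 < n)
    (hK : 1 ≤ K) (hν : IsNormalizedEnsemble ν)
    (hc1 : 1 ≤ c) (hi : MatIntegrable ν fun G => (G * Gᴴ) ^ K)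
    (hc : opNorm (matExpect ν fun G => (G * Gᴴ) ^ K) ≤ c)
    (hd : ∀ S, Q S ≠ 0 → S.card ≤ d) (hW : ∑ S, hsSq (Q S) ≤ n) :
    ∫ x, Q.rotatedTrace p K x ∂(inputLaw m p ν) ≤ Q.signMoment K
      + ((K : ℝ) ^ (d * K) * c ^ d + 1) * (K * (K - 1) * (d * Q.maxInfluence * n ^ (K - 1)))
      + ((2 : ℝ) ^ m) ^ (2 * K) *
        (n * n ^ K * (1 + n) ^ m * ((m + m ^ 2) * (n ^ 2 / √p))) / n := by
  have hQ : ∀ S, hsSq (Q S) ≤ n := fun S =>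
    (Finset.single_le_sum (f := fun S => hsSq (Q S)) (fun _ _ => hsSq_nonneg _)
      (Finset.mem_univ S)).trans hW
  have h1 := Q.integral_rotatedTrace_le h hn hK hc1 hi hc hd (fun κ => ∃ i, 2 ≤ κ i)
    (Finset.univ.filter fun S => S.card ≤ 1)
    (E := n * n ^ K * (1 + n) ^ m * ((m + m ^ 2) * (n ^ 2 / √p))) (by positivity) (by
    intro s t hs hst
    push Not at hs
    have hs' : ∀ i, mult s i ≤ 1 := fun i => Nat.lt_succ_iff.1 (hs i)
    simp only [Finset.mem_filter, Finset.mem_univ, true_and]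
    split_ifs with hdiag
    · obtain ⟨rfl, hcard⟩ := hdiag
      rw [Q.integral_wordTrace_diagonal h hK hν hcard hs']
      exact le_add_of_nonneg_right (by positivity)
    · rw [zero_add]
      exact (Complex.re_le_norm _).trans
        (Q.norm_integral_wordTrace_le h hn hK hν hQ hs' (hst ▸ hs') hdiag))
  refine h1.trans (add_le_add_left (add_le_add_right
    (mul_le_mul_of_nonneg_left (Q.sum_repeated_le hK hd hW) ?_) _) _)
  have : 0 ≤ c := zero_le_one.trans hc1
  positivity

end Comparison

/-! ### Numerical estimates -/

/-- Bernoulli's inequality: `2 * K - 1` exceeds the base `K` of the hypercontractive bound by enough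
to gain a factor `K` for each degree. -/
lemma pow_mul_le_two_mul_sub_one_pow {K : ℕ} (hK : 1 ≤ K) (d : ℕ) :
    (K : ℝ) ^ (d * K) * K ^ d ≤ (2 * (K : ℝ) - 1) ^ (d * K) := by
  have hK1 : (1 : ℝ) ≤ K := by exact_mod_cast hK
  have hK0 : (K : ℝ) ≠ 0 := by positivity
  have h1 : (K : ℝ) ^ K * K ≤ (2 * (K : ℝ) - 1) ^ K := by
    have hB := one_add_mul_le_pow (a := ((K : ℝ) - 1) / K)
      (le_trans (by norm_num) (div_nonneg (by linarith) (by linarith))) K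
    have e : (1 : ℝ) + K * (((K : ℝ) - 1) / K) = K := by field_simp; ring
    rw [e] at hB
    calc (K : ℝ) ^ K * K ≤ (K : ℝ) ^ K * (1 + ((K : ℝ) - 1) / K) ^ K :=
          mul_le_mul_of_nonneg_left hB (by positivity)
      _ = _ := by
          rw [← mul_pow]
          congr 1
          field_simp
          ring
  calc (K : ℝ) ^ (d * K) * K ^ d = ((K : ℝ) ^ K * K) ^ d := by
        rw [mul_pow, ← pow_mul, mul_comm d K]
    _ ≤ ((2 * (K : ℝ) - 1) ^ K) ^ d := pow_le_pow_left₀ (by positivity) h1 d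
    _ = _ := by rw [← pow_mul, mul_comm d K]

/-- For `τ ≤ n`, a bound linear in the influence is stronger than one in `τ ^ (1 / 4)`. -/
lemma le_mul_rpow_quarter {τ : ℝ} {n : ℕ} (hn : 0 < n) (h0 : 0 ≤ τ) (h : τ ≤ n) :
    τ ≤ n * τ ^ (1 / 4 : ℝ) := by
  rcases h0.eq_or_lt with rfl | hpos
  · rw [Real.zero_rpow (by norm_num), mul_zero]
  have hn1 : (1 : ℝ) ≤ n := by exact_mod_cast hn
  have e : τ = τ ^ (3 / 4 : ℝ) * τ ^ (1 / 4 : ℝ) := by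
    rw [← Real.rpow_add hpos]; norm_num
  have h1 : τ ^ (3 / 4 : ℝ) ≤ n := by
    calc τ ^ (3 / 4 : ℝ) ≤ (n : ℝ) ^ (3 / 4 : ℝ) := Real.rpow_le_rpow h0 h (by norm_num)
      _ ≤ (n : ℝ) ^ (1 : ℝ) := Real.rpow_le_rpow_of_exponent_le hn1 (by norm_num)
      _ = n := Real.rpow_one _
  calc τ = τ ^ (3 / 4 : ℝ) * τ ^ (1 / 4 : ℝ) := e
    _ ≤ _ := mul_le_mul_of_nonneg_right h1 (Real.rpow_nonneg h0 _)

/-- The influence error of the majorization principle. -/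
noncomputable def influenceError (n K d : ℕ) (c τ : ℝ) : ℝ :=
  (K : ℝ) ^ 3 * ((2 * (K : ℝ) - 1) ^ (d * K) * c ^ d) * (n : ℝ) ^ (2 * K) * τ ^ (1 / 4 : ℝ)

/-- A crude error term is absorbed by the influence error as soon as `2 * A` is at most
`K ^ (d + 3)`. -/
lemma mul_le_influenceError {n K d : ℕ} {c τ A : ℝ} (hn : 0 < n) (hK : 1 ≤ K) (hc1 : 1 ≤ c)
    (h0 : 0 ≤ τ) (h : τ ≤ n) (hA0 : 0 ≤ A) (hA : 2 * A ≤ (K : ℝ) ^ 3 * K ^ d) :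
    ((K : ℝ) ^ (d * K) * c ^ d + 1) * (A * (τ * n ^ (K - 1))) ≤ influenceError n K d c τ := by
  have hK1 : (1 : ℝ) ≤ K := by exact_mod_cast hK
  have hn1 : (1 : ℝ) ≤ n := by exact_mod_cast hn
  have hc0 : 0 ≤ c := zero_le_one.trans hc1
  have h1 : (K : ℝ) ^ (d * K) * c ^ d + 1 ≤ 2 * ((K : ℝ) ^ (d * K) * c ^ d) := by
    have : (1 : ℝ) ≤ (K : ℝ) ^ (d * K) * c ^ d :=
      one_le_mul_of_one_le_of_one_le (one_le_pow₀ hK1) (one_le_pow₀ hc1)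
    linarith
  have h2 : τ * (n : ℝ) ^ (K - 1) ≤ (n : ℝ) ^ (2 * K) * τ ^ (1 / 4 : ℝ) := by
    calc τ * (n : ℝ) ^ (K - 1) ≤ (n * τ ^ (1 / 4 : ℝ)) * (n : ℝ) ^ (K - 1) :=
          mul_le_mul_of_nonneg_right (le_mul_rpow_quarter hn h0 h) (by positivity)
      _ = (n : ℝ) ^ (K - 1 + 1) * τ ^ (1 / 4 : ℝ) := by ring
      _ ≤ _ := by
          refine mul_le_mul_of_nonneg_right (pow_le_pow_right₀ hn1 (by omega))
            (Real.rpow_nonneg h0 _)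
  have h3 := pow_mul_le_two_mul_sub_one_pow hK d
  have hX : 0 ≤ (n : ℝ) ^ (2 * K) * τ ^ (1 / 4 : ℝ) :=
    mul_nonneg (by positivity) (Real.rpow_nonneg h0 _)
  calc _ ≤ (2 * ((K : ℝ) ^ (d * K) * c ^ d)) * (A * ((n : ℝ) ^ (2 * K) * τ ^ (1 / 4 : ℝ))) := by
        refine mul_le_mul h1 (mul_le_mul_of_nonneg_left h2 hA0)
          (mul_nonneg hA0 (mul_nonneg h0 (by positivity))) (by positivity)
    _ = (2 * A) * ((K : ℝ) ^ (d * K) * c ^ d * ((n : ℝ) ^ (2 * K) * τ ^ (1 / 4 : ℝ))) := by ring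
    _ ≤ ((K : ℝ) ^ 3 * K ^ d) *
        ((K : ℝ) ^ (d * K) * c ^ d * ((n : ℝ) ^ (2 * K) * τ ^ (1 / 4 : ℝ))) := by
        refine mul_le_mul_of_nonneg_right hA (mul_nonneg (by positivity) hX)
    _ = (K : ℝ) ^ 3 * (((K : ℝ) ^ (d * K) * K ^ d) * c ^ d) *
        ((n : ℝ) ^ (2 * K) * τ ^ (1 / 4 : ℝ)) := by ring
    _ ≤ (K : ℝ) ^ 3 * ((2 * (K : ℝ) - 1) ^ (d * K) * c ^ d) *
        ((n : ℝ) ^ (2 * K) * τ ^ (1 / 4 : ℝ)) := by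
        refine mul_le_mul_of_nonneg_right (mul_le_mul_of_nonneg_left
          (mul_le_mul_of_nonneg_right h3 (by positivity)) (by positivity)) hX
    _ = _ := by rw [influenceError]; ring

/-- The coefficient of `p ^ (-1 / 2)`, which bounds the total weight of the off-diagonal words when
`K ≤ 2 * m`. -/
noncomputable def cornerConst (m n : ℕ) : ℝ :=
  ((2 : ℝ) ^ m) ^ (4 * m) * (n ^ (2 * m) * (1 + n) ^ m * ((m + m ^ 2) * n ^ 2))

section Majorization
variable {n m p K d : ℕ} {ν : Measure (Matrix (Fin n) (Fin n) ℂ)} [IsProbabilityMeasure ν] {c : ℝ}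

lemma NCPoly.integral_rotatedTrace_le_signMoment_add (Q : NCPoly n m) (h : n ≤ p) (hn : 0 < n)
    (hK : 1 ≤ K) (hν : IsNormalizedEnsemble ν)
    (hc1 : 1 ≤ c) (hi : MatIntegrable ν fun G => (G * Gᴴ) ^ K)
    (hc : opNorm (matExpect ν fun G => (G * Gᴴ) ^ K) ≤ c)
    (hd : ∀ S, Q S ≠ 0 → S.card ≤ d) (hW : ∑ S, hsSq (Q S) ≤ n) :
    ∫ x, Q.rotatedTrace p K x ∂(inputLaw m p ν) ≤ Q.signMoment K
      + influenceError n K d c Q.maxInfluence + cornerConst m n / √p := by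
  have hτ0 := Q.maxInfluence_nonneg
  have hτ : Q.maxInfluence ≤ n := Q.maxInfluence_le.trans hW
  have hK1 : (1 : ℝ) ≤ K := by exact_mod_cast hK
  have hn1 : (1 : ℝ) ≤ n := by exact_mod_cast hn
  have hC : 0 ≤ cornerConst m n / √p := by unfold cornerConst; positivity
  rcases le_or_gt (2 * m) K with hmK | hmK
  · -- `K` exceeds the number of variables by so much that all nontrivial words are absorbed by the
    -- influence error; otherwise `K` is bounded in terms of `m`
    refine (Q.integral_rotatedTrace_le_of_influence h hn hK hν hc1 hi hc hd hW).trans ?_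
    have hA := mul_le_influenceError (A := K * m) (d := d) hn hK hc1 hτ0 hτ (by positivity) (by
      have h2 : (2 : ℝ) * m ≤ K := by exact_mod_cast hmK
      have h3 : (1 : ℝ) ≤ (K : ℝ) ^ d := one_le_pow₀ hK1
      calc (2 : ℝ) * (K * m) = K * (2 * m) := by ring
        _ ≤ K * K := by gcongr
        _ ≤ K * K * K := le_mul_of_one_le_right (by positivity) hK1
        _ ≤ K * K * K * K ^ d := le_mul_of_one_le_right (by positivity) h3
        _ = _ := by ring)
    have e : (K : ℝ) * (m * Q.maxInfluence * n ^ (K - 1))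
        = K * m * (Q.maxInfluence * n ^ (K - 1)) := by ring
    rw [e]
    linarith
  · refine (Q.integral_rotatedTrace_le_of_corner h hn hK hν hc1 hi hc hd hW).trans ?_
    have hA := mul_le_influenceError (A := K * (K - 1) * d) (d := d) hn hK hc1 hτ0 hτ
      (mul_nonneg (mul_nonneg (by positivity) (by linarith)) (by positivity)) (by
      rcases hK.eq_or_lt with rfl | hK2
      · simp
      have h2 : (2 : ℝ) ≤ K := by exact_mod_cast hK2
      have h3 : (d : ℝ) ≤ (K : ℝ) ^ d := by
        have : d ≤ 2 ^ d := Nat.lt_two_pow_self.le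
        calc (d : ℝ) ≤ 2 ^ d := by exact_mod_cast this
          _ ≤ _ := pow_le_pow_left₀ (by norm_num) h2 d
      have h4 : 2 * (K * ((K : ℝ) - 1)) ≤ K ^ 3 := by nlinarith [sq_nonneg ((K : ℝ) - 2)]
      calc 2 * (K * ((K : ℝ) - 1) * d) = (2 * (K * ((K : ℝ) - 1))) * d := by ring
        _ ≤ K ^ 3 * K ^ d := mul_le_mul h4 h3 (by positivity) (by positivity))
    have e : (K : ℝ) * (K - 1) * (d * Q.maxInfluence * n ^ (K - 1))
        = K * (K - 1) * d * (Q.maxInfluence * n ^ (K - 1)) := by ring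
    rw [e]
    refine add_le_add (add_le_add_right hA _) ?_
    have hp : (0 : ℝ) < √p := Real.sqrt_pos.2 (by exact_mod_cast hn.trans_le h)
    have hn0 : (n : ℝ) ≠ 0 := by positivity
    have e2 : ((2 : ℝ) ^ m) ^ (2 * K) * (n * n ^ K * (1 + n) ^ m * ((m + m ^ 2) * (n ^ 2 / √p))) / n
        = ((2 : ℝ) ^ m) ^ (2 * K) * (n ^ K * (1 + n) ^ m * ((m + m ^ 2) * n ^ 2)) / √p := by
      field_simp
    rw [e2, cornerConst]
    have h1 : (1 : ℝ) ≤ 2 ^ m := one_le_pow₀ (by norm_num)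
    have h3 : ((2 : ℝ) ^ m) ^ (2 * K) ≤ ((2 : ℝ) ^ m) ^ (4 * m) :=
      pow_le_pow_right₀ h1 (by omega)
    have h4 : (n : ℝ) ^ K ≤ (n : ℝ) ^ (2 * m) := pow_le_pow_right₀ hn1 (by omega)
    refine div_le_div_of_nonneg_right (mul_le_mul h3 ?_ (by positivity) (by positivity)) hp.le
    exact mul_le_mul_of_nonneg_right (mul_le_mul_of_nonneg_right h4 (by positivity)) (by positivity)

end Majorization
end NCMajorization

open NCMajorization
theorem mainTheorem3 (m n : ℕ) (hm : 0 < m) (hn : 0 < n) :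
    ∃ C : ℝ, 0 < C ∧
      ∀ (p K d : ℕ) (_ : n < p) (_ : 1 ≤ K)
        (Q : NCPoly n m) (_ : Q.degree ≤ d)
        (_ : ∀ σ : Fin m → ℤˣ, opNorm (Q.evalSign σ) ≤ 1)
        (ν : Measure (Matrix (Fin n) (Fin n) ℂ)) (_ : IsProbabilityMeasure ν)
        (_ : IsNormalizedEnsemble ν)
        (c : ℝ) (_ : 1 ≤ c)
        (_ : MatIntegrable ν fun G => (G * G.conjTranspose) ^ K)
        (_ : opNorm (matExpect ν fun G => (G * G.conjTranspose) ^ K) ≤ c),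
        Integrable (Q.rotatedTrace p K) (inputLaw m p ν) ∧
        ∫ x, Q.rotatedTrace p K x ∂(inputLaw m p ν) ≤
          Q.signMoment K
            + (K : ℝ) ^ 3 * ((2 * (K : ℝ) - 1) ^ (d * K) * c ^ d) * (n : ℝ) ^ (2 * K)
                * Q.maxInfluence ^ (1 / 4 : ℝ)
            + C * ((p : ℝ) ^ (-(1 / 2) : ℝ) * (K : ℝ) ^ 2 * Q.maxInfluence ^ (-(1 / 4) : ℝ)) ∧
        (K = 2 →
          ∫ x, Q.rotatedTrace p K x ∂(inputLaw m p ν) ≤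
            Q.signMoment K
              + 8 * (8 * c) ^ (4 * d) * (n : ℝ) ^ 4 * Q.maxInfluence ^ (1 / 4 : ℝ)
              + C * (p : ℝ) ^ (-(1 / 2) : ℝ)) := by
  have hn1 : (1 : ℝ) ≤ n := by exact_mod_cast hn
  have hC0 : 0 < cornerConst m n := by unfold cornerConst; positivity
  -- the factor `n` pays for `maxInfluence ^ (-1 / 4) ≥ n ^ (-1 / 4)`
  refine ⟨n * cornerConst m n, by positivity, ?_⟩
  intro p K d hp hK Q hdeg hQ ν hνp hν c hc1 hi hc
  have hnp : n ≤ p := hp.le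
  have hd : ∀ S, Q S ≠ 0 → S.card ≤ d := fun S hS => by
    classical
    refine le_trans ?_ hdeg
    rw [NCPoly.degree]
    exact Finset.le_sup (f := Finset.card) (by simpa using hS)
  have hW := Q.sum_hsSq_le hQ
  have hτ0 := Q.maxInfluence_nonneg
  have hτ : Q.maxInfluence ≤ n := Q.maxInfluence_le.trans hW
  have hK1 : (1 : ℝ) ≤ K := by exact_mod_cast hK
  have hc0 : 0 ≤ c := zero_le_one.trans hc1
  have hmain := Q.integral_rotatedTrace_le_signMoment_add hnp hn hK hν hc1 hi hc hd hW
  have hp0 : (0 : ℝ) < p := by exact_mod_cast hn.trans hp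
  have hsqrt : (p : ℝ) ^ (-(1 / 2) : ℝ) = 1 / √p := by
    rw [Real.rpow_neg hp0.le, ← Real.sqrt_eq_rpow, one_div]
  have hs0 : 0 < √(p : ℝ) := Real.sqrt_pos.2 hp0
  refine ⟨(Q.integral_rotatedTrace hnp hK hi).1, ?_, ?_⟩
  · rcases hτ0.eq_or_lt with h0 | hpos
    · -- `0 ^ (-1 / 4) = 0`, so here the moments are compared without any error term
      have h1 := Q.integral_rotatedTrace_le_of_influence hnp hn hK hν hc1 hi hc hd hW
      rw [← h0] at h1 ⊢
      rw [Real.zero_rpow (by norm_num), Real.zero_rpow (by norm_num)]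
      simpa using h1
    · refine hmain.trans (add_le_add le_rfl ?_)
      have h1 : 1 ≤ n * Q.maxInfluence ^ (-(1 / 4) : ℝ) := by
        rw [Real.rpow_neg hτ0, ← div_eq_mul_inv, one_le_div (Real.rpow_pos_of_pos hpos _)]
        calc Q.maxInfluence ^ (1 / 4 : ℝ) ≤ (n : ℝ) ^ (1 / 4 : ℝ) :=
              Real.rpow_le_rpow hτ0 hτ (by norm_num)
          _ ≤ (n : ℝ) ^ (1 : ℝ) := Real.rpow_le_rpow_of_exponent_le hn1 (by norm_num)
          _ = n := Real.rpow_one _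
      have h2 : (1 : ℝ) ≤ (K : ℝ) ^ 2 := one_le_pow₀ hK1
      have h3 : 1 ≤ (n * Q.maxInfluence ^ (-(1 / 4) : ℝ)) * (K : ℝ) ^ 2 :=
        one_le_mul_of_one_le_of_one_le h1 h2
      calc cornerConst m n / √p
          ≤ cornerConst m n / √p * ((n * Q.maxInfluence ^ (-(1 / 4) : ℝ)) * (K : ℝ) ^ 2) :=
            le_mul_of_one_le_right (by positivity) h3
        _ = _ := by rw [hsqrt]; ring
  · rintro rfl
    refine hmain.trans (add_le_add (add_le_add le_rfl ?_) ?_)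
    · rw [influenceError]
      refine mul_le_mul_of_nonneg_right ?_ (Real.rpow_nonneg hτ0 _)
      have h1 : (9 * c) ^ d ≤ (8 * c) ^ (4 * d) := by
        rw [pow_mul]
        refine pow_le_pow_left₀ (by positivity) ?_ d
        have : c ≤ c ^ 4 := le_self_pow₀ hc1 (by norm_num)
        calc 9 * c ≤ 4096 * c ^ 4 := by linarith
          _ = _ := by ring
      have e : ((2 : ℕ) : ℝ) ^ 3 * ((2 * ((2 : ℕ) : ℝ) - 1) ^ (d * 2) * c ^ d) * (n : ℝ) ^ (2 * 2)
          = 8 * (9 * c) ^ d * (n : ℝ) ^ 4 := by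
        rw [mul_comm d 2, pow_mul, mul_pow]
        norm_num
      rw [e]
      gcongr
    · rw [hsqrt, mul_one_div]
      gcongr
      exact le_mul_of_one_le_left hC0.le hn1
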